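/- A (tight) $k$-hypercycle in a $u$-uniform hypergraph is a list of $k$ distinct nodes $v_0,\dots,v_{k-1}$ such that for every $i$ the set $\{v_i,v_{i+1},\dots,v_{i+u-1}\}$ of $u$ cyclically consecutive nodes (indices modulo $k$) is a hyperedge; its weight is the sum of the weights of these $k$ hyperedges. The weight of a $k$-clique in an edge-weighted graph is the sum of the weights of its $\binom k2$ edges. A problem on $n$-node instances "requires $n^{k-o(1)}$ time" if for no $\varepsilon>0$ it is solved by an algorithm that runs in $O(n^{k-\varepsilon})$ time on a Word-RAM with $O(\log n)$-bit words. The minimum-weight $k$-clique hypothesis says that there is a constant $c>1$ such that finding a $k$-clique of minimum total edge weight (or reporting that there is no $k$-clique) in an $n$-node graph with integer edge weights in $[1,n^{ck}]$ requires $n^{k-o(1)}$ time. Theorem. Let $u$ and $k$ be integers with $u+1\le k\le 2u-1$, and assume the minimum-weight $k$-clique hypothesis. Then finding a minimum-weight $k$-hypercycle (or reporting that there is no $k$-hypercycle) in an $n$-node hyperedge-weighted $u$-uniform hypergraph requires $n^{k-o(1)}$ time; in fact there is a constant $c>1$ such that this already holds for integer hyperedge weights in $[1,n^{ck}]$. The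 theorem holds both when all algorithms, in the hypothesis and in the conclusion, are deterministic, and when they are all randomized (worst-case time bound, correct with probability at least $2/3$ on every instance). -/

import Mathlib

/-! ## The Word-RAM -/

namespace WordRAM

/-- The binary word operations of the machine. -/
inductive BinOp
  | add | sub | mul | div | mod | and | or | xor | shl | shr | lt | eq

/-- The value of a word operation, before it is checked to fit into a word. Subtraction is
truncated at `0`, division by `0` gives `0`, and the comparisons give `1` (true) or `0` (false). -/
def BinOp.eval : BinOp → ℕ → ℕ → ℕ
  | .add, x, y => x + y
  | .sub, x, y => x - y
  | .mul, x, y => x * y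
  | .div, x, y => x / y
  | .mod, x, y => x % y
  | .and, x, y => x &&& y
  | .or, x, y => x ||| y
  | .xor, x, y => x ^^^ y
  | .shl, x, y => x <<< y
  | .shr, x, y => x >>> y
  | .lt, x, y => if x < y then 1 else 0
  | .eq, x, y => if x = y then 1 else 0

/-- Instructions. `r`, `a`, `b` are names of registers; `t` is a position in the program. -/
inductive Instr
  /-- `r := v` -/
  | const (r v : ℕ)
  /-- `r := a o b` -/
  | op (o : BinOp) (r a b : ℕ)
  /-- `r := memory[a]` -/
  | load (r a : ℕ)
  /-- `memory[a] := b` -/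
  | store (a b : ℕ)
  /-- go to `t` -/
  | jump (t : ℕ)
  /-- go to `t` if `a` is not `0` -/
  | jumpNonzero (a t : ℕ)
  /-- `r :=` a fresh random bit -/
  | flip (r : ℕ)

/-- A program is a finite list of instructions (so it mentions finitely many registers). -/
abbrev Program := List Instr

/-- Programs that never toss a coin. -/
def Program.Deterministic (p : Program) : Prop := ∀ r, Instr.flip r ∉ p

/-- A configuration: program counter, registers, random-access memory, and the number of coins
tossed so far. -/
structure Config where
  pc : ℕ
  reg : ℕ → ℕ
  mem : ℕ → ℕ
  coins : ℕ

/-- The initial configuration on a given memory content. -/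
def initial (input : ℕ → ℕ) : Config := ⟨0, fun _ => 0, input, 0⟩

/-- Put `v` into register `r` and go to the next instruction, on a machine with `w`-bit words.
A value that does not fit into `w` bits is an error, and the computation is aborted. Hence all
values and all addresses that are used by a computation are `w`-bit words. -/
def Config.put (w : ℕ) (s : Config) (r v : ℕ) : Option Config :=
  if v < 2 ^ w then some { s with pc := s.pc + 1, reg := Function.update s.reg r v } else none

/-- The effect of one instruction, on a machine with `w`-bit words and coin tosses `ω`. -/
def exec (w : ℕ) (ω : ℕ → Bool) (s : Config) : Instr → Option Config
  | .const r v => s.put w r v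
  | .op o r a b => s.put w r (o.eval (s.reg a) (s.reg b))
  | .load r a => s.put w r (s.mem (s.reg a))
  | .store a b =>
      some { s with pc := s.pc + 1, mem := Function.update s.mem (s.reg a) (s.reg b) }
  | .jump t => some { s with pc := t }
  | .jumpNonzero a t => some { s with pc := if s.reg a = 0 then s.pc + 1 else t }
  | .flip r => ({ s with coins := s.coins + 1 } : Config).put w r (ω s.coins).toNat

/-- One step of program `p`. No step is possible after the program counter has left the
program. -/
def step (p : Program) (w : ℕ) (ω : ℕ → Bool) (s : Config) : Option Config :=
  p[s.pc]?.bind (exec w ω s)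

/-- Exactly `t` steps of program `p`. -/
def run (p : Program) (w : ℕ) (ω : ℕ → Bool) : ℕ → Config → Option Config
  | 0, s => some s
  | t + 1, s => (step p w ω s).bind (run p w ω t)

/-- Started on memory content `input`, program `p` halts regularly (the program counter has left
the program) after at most `T` steps, with a final memory content that satisfies `Q`. -/
def HaltsWithin (p : Program) (w : ℕ) (ω : ℕ → Bool) (input : ℕ → ℕ) (T : ℝ)
    (Q : (ℕ → ℕ) → Prop) : Prop :=
  ∃ (t : ℕ) (s : Config), (t : ℝ) ≤ T ∧ run p w ω t (initial input) = some s ∧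
    p.length ≤ s.pc ∧ Q s.mem

/-- The law of a sequence of independent fair coin tosses. -/
noncomputable def coinLaw : MeasureTheory.Measure (ℕ → Bool) :=
  MeasureTheory.Measure.infinitePi fun _ : ℕ => (PMF.uniformOfFintype Bool).toMeasure

/-- The two standard kinds of algorithms. -/
inductive Mode
  | deterministic
  | randomized

/-- With `w`-bit words, program `p` always halts within `T` steps on memory content `input`, and
its final memory content satisfies `Q`: certainly, and without coin tosses, for deterministic
algorithms, and with probability at least `2/3` for randomized ones. -/
def Computes : Mode → (p : Program) → (w : ℕ) → (input : ℕ → ℕ) → (T : ℝ) →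
    (Q : (ℕ → ℕ) → Prop) → Prop
  | .deterministic, p, w, input, T, Q =>
      p.Deterministic ∧ ∀ ω, HaltsWithin p w ω input T Q
  | .randomized, p, w, input, T, Q =>
      (∀ ω, HaltsWithin p w ω input T fun _ => True) ∧
        2 / 3 ≤ coinLaw {ω | HaltsWithin p w ω input T Q}

/-- A search problem, with instances sorted by a size parameter `n`: how an instance is stored in
memory, and which final memory contents are correct answers to it. -/
structure SearchProblem where
  Instance : ℕ → Type
  input : {n : ℕ} → Instance n → ℕ → ℕ
  Correct : {n : ℕ} → Instance n → (ℕ → ℕ) → Prop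

/-- The problem can be solved in time `O(n ^ e)` on a Word-RAM with `O(log n)`-bit words: one
program solves all instances, with words of `d * (⌊log₂ n⌋ + 1)` bits and in at most `C * n ^ e`
steps, for some constants `d` and `C`. -/
def SolvableInTime (m : Mode) (P : SearchProblem) (e : ℝ) : Prop :=
  ∃ (p : Program) (d : ℕ) (C : ℝ), ∀ n : ℕ, 1 ≤ n → ∀ I : P.Instance n,
    Computes m p (d * (Nat.log 2 n + 1)) (P.input I) (C * (n : ℝ) ^ e) (P.Correct I)

/-- The problem requires time `n ^ (e - o(1))` on a Word-RAM with `O(log n)`-bit words. -/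
def RequiresTime (m : Mode) (P : SearchProblem) (e : ℝ) : Prop :=
  ∀ ε : ℝ, 0 < ε → ¬ SolvableInTime m P (e - ε)

end WordRAM

/-! ## Minimum-weight `k`-clique -/

/-- A graph on `n` nodes with integer edge weights in `[1, B]`. Values of `weight` at non-edges
are irrelevant. -/
structure WeightedGraph (n : ℕ) (B : ℝ) where
  graph : SimpleGraph (Fin n)
  weight : Sym2 (Fin n) → ℕ
  one_le_weight : ∀ e ∈ graph.edgeSet, 1 ≤ weight e
  weight_le : ∀ e ∈ graph.edgeSet, (weight e : ℝ) ≤ B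

namespace WeightedGraph

variable {n : ℕ} {B : ℝ}

/-- The total weight of the pairs of distinct nodes of `S`. -/
def cliqueWeight (G : WeightedGraph n B) (S : Finset (Fin n)) : ℕ :=
  ∑ e ∈ S.sym2 with ¬ e.IsDiag, G.weight e

/-- `S` is a `k`-clique of minimum total edge weight. -/
def IsMinClique (G : WeightedGraph n B) (k : ℕ) (S : Finset (Fin n)) : Prop :=
  G.graph.IsNClique k S ∧
    ∀ S', G.graph.IsNClique k S' → G.cliqueWeight S ≤ G.cliqueWeight S'

open Classical in
/-- A weighted graph in memory: the number of nodes, followed by the weighted adjacency matrix,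
in which `0` stands for a non-edge. The entry `(x 0, x 1)` is at address `1 + x 0 + x 1 * n`. -/
noncomputable def input (G : WeightedGraph n B) (a : ℕ) : ℕ :=
  if a = 0 then n
  else if h : a - 1 < n ^ 2 then
    let x : Fin 2 → Fin n := finFunctionFinEquiv.symm ⟨a - 1, h⟩
    if G.graph.Adj (x 0) (x 1) then G.weight s(x 0, x 1) else 0
  else 0

/-- The memory holds a correct answer: `1` followed by the `k` nodes of a minimum-weight
`k`-clique, or `0` if there is no `k`-clique. -/
def CorrectAnswer (G : WeightedGraph n B) (k : ℕ) (mem : ℕ → ℕ) : Prop :=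
  (mem 0 = 1 ∧ ∃ v : Fin k → Fin n, (∀ i : Fin k, mem (i + 1) = v i) ∧
      G.IsMinClique k (Finset.univ.image v)) ∨
    (mem 0 = 0 ∧ ∀ S, ¬ G.graph.IsNClique k S)

end WeightedGraph

/-- Find a minimum-weight `k`-clique in an `n`-node graph with integer edge weights in
`[1, n ^ (c * k)]`. -/
noncomputable def minCliqueProblem (c : ℝ) (k : ℕ) : WordRAM.SearchProblem where
  Instance n := WeightedGraph n ((n : ℝ) ^ (c * k))
  input G := G.input
  Correct G := G.CorrectAnswer k

/-- The minimum-weight `k`-clique hypothesis. -/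
def MinCliqueHypothesis (m : WordRAM.Mode) (k : ℕ) : Prop :=
  ∃ c : ℝ, 1 < c ∧ WordRAM.RequiresTime m (minCliqueProblem c k) k

/-! ## Minimum-weight `k`-hypercycle -/

/-- A `u`-uniform hypergraph on `n` nodes with integer hyperedge weights in `[1, B]`. Values of
`weight` at sets that are not hyperedges are irrelevant. -/
structure WeightedHypergraph (n u : ℕ) (B : ℝ) where
  edges : Set (Finset (Fin n))
  card_eq : ∀ e ∈ edges, e.card = u
  weight : Finset (Fin n) → ℕ
  one_le_weight : ∀ e ∈ edges, 1 ≤ weight e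
  weight_le : ∀ e ∈ edges, (weight e : ℝ) ≤ B

/-- The set of the `u` cyclically consecutive nodes `v i, v (i + 1), …, v (i + u - 1)`, with
indices modulo `k`. -/
def cyclicWindow {n k : ℕ} (u : ℕ) (v : Fin k → Fin n) (i : Fin k) : Finset (Fin n) :=
  Finset.univ.image fun j : Fin u => v ⟨(i + j) % k, Nat.mod_lt _ i.pos⟩

namespace WeightedHypergraph

variable {n u : ℕ} {B : ℝ}

/-- `v` is a (tight) `k`-hypercycle: its `k` nodes are distinct, and every set of `u` cyclically
consecutive ones is a hyperedge. -/
def IsHypercycle (H : WeightedHypergraph n u B) {k : ℕ} (v : Fin k → Fin n) : Prop :=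
  Function.Injective v ∧ ∀ i, cyclicWindow u v i ∈ H.edges

/-- The total weight of the `k` hyperedges of a hypercycle. -/
def cycleWeight (H : WeightedHypergraph n u B) {k : ℕ} (v : Fin k → Fin n) : ℕ :=
  ∑ i, H.weight (cyclicWindow u v i)

/-- `v` is a `k`-hypercycle of minimum total weight. -/
def IsMinHypercycle (H : WeightedHypergraph n u B) {k : ℕ} (v : Fin k → Fin n) : Prop :=
  H.IsHypercycle v ∧
    ∀ v' : Fin k → Fin n, H.IsHypercycle v' → H.cycleWeight v ≤ H.cycleWeight v'

open Classical in
/-- A weighted hypergraph in memory: the number of nodes, followed by the weighted adjacency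
tensor, in which `0` stands for a tuple that does not form a hyperedge. The entry
`(x 0, …, x (u - 1))` is at address `1 + ∑ j, x j * n ^ j`. -/
noncomputable def input (H : WeightedHypergraph n u B) (a : ℕ) : ℕ :=
  if a = 0 then n
  else if h : a - 1 < n ^ u then
    let x : Fin u → Fin n := finFunctionFinEquiv.symm ⟨a - 1, h⟩
    if Finset.univ.image x ∈ H.edges then H.weight (Finset.univ.image x) else 0
  else 0

/-- The memory holds a correct answer: `1` followed by the `k` nodes, in cyclic order, of a
minimum-weight `k`-hypercycle, or `0` if there is no `k`-hypercycle. -/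
def CorrectAnswer (H : WeightedHypergraph n u B) (k : ℕ) (mem : ℕ → ℕ) : Prop :=
  (mem 0 = 1 ∧ ∃ v : Fin k → Fin n, (∀ i : Fin k, mem (i + 1) = v i) ∧ H.IsMinHypercycle v) ∨
    (mem 0 = 0 ∧ ∀ v : Fin k → Fin n, ¬ H.IsHypercycle v)

end WeightedHypergraph

/-- Find a minimum-weight `k`-hypercycle in an `n`-node `u`-uniform hypergraph with integer
hyperedge weights in `[1, n ^ (c * k)]`. -/
noncomputable def minHypercycleProblem (c : ℝ) (u k : ℕ) : WordRAM.SearchProblem where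
  Instance n := WeightedHypergraph n u ((n : ℝ) ^ (c * k))
  input H := H.input
  Correct H := H.CorrectAnswer k

namespace WordRAM

/-! ### Runs -/

variable {p q : Program} {w w' : ℕ} {ω : ℕ → Bool}

theorem run_add (p : Program) (w : ℕ) (ω : ℕ → Bool) (a b : ℕ) (s : Config) :
    run p w ω (a + b) s = (run p w ω a s).bind (run p w ω b) := by
  induction a generalizing s with
  | zero => simp [run]
  | succ a ih =>
    rw [Nat.add_right_comm]
    simp only [run, Option.bind_assoc]
    exact congrArg _ (funext ih)

theorem run_trans {a b : ℕ} {s s' s'' : Config} (h : run p w ω a s = some s')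
    (h' : run p w ω b s' = some s'') : run p w ω (a + b) s = some s'' := by
  rw [run_add, h, Option.bind_some, h']

theorem run_one (s : Config) : run p w ω 1 s = step p w ω s := by
  simp [run]

theorem Config.put_mono (h : w ≤ w') {s s' : Config} {r v : ℕ} (hs : s.put w r v = some s') :
    s.put w' r v = some s' := by
  unfold Config.put at hs ⊢
  split_ifs at hs with hv
  rw [if_pos (hv.trans_le (Nat.pow_le_pow_right two_pos h)), hs]

theorem exec_mono (h : w ≤ w') {s s' : Config} {i : Instr} (hs : exec w ω s i = some s') :
    exec w' ω s i = some s' := by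
  cases i <;> first | exact hs | exact Config.put_mono h hs

theorem step_mono (h : w ≤ w') {s s' : Config} (hs : step p w ω s = some s') :
    step p w' ω s = some s' := by
  obtain ⟨i, hi, hs⟩ := Option.bind_eq_some_iff.1 hs
  exact Option.bind_eq_some_iff.2 ⟨i, hi, exec_mono h hs⟩

/-- A run that does not overflow is the same with larger words. -/
theorem run_mono (h : w ≤ w') {t : ℕ} {s s' : Config} (hs : run p w ω t s = some s') :
    run p w' ω t s = some s' := by
  induction t generalizing s with
  | zero => exact hs
  | succ t ih =>
    obtain ⟨s₁, h₁, h₂⟩ := Option.bind_eq_some_iff.1 hs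
    exact Option.bind_eq_some_iff.2 ⟨s₁, step_mono h h₁, ih h₂⟩

/-- All registers and memory cells hold numbers below `B`. -/
def Config.Bounded (B : ℕ) (s : Config) : Prop :=
  (∀ r, s.reg r < B) ∧ ∀ a, s.mem a < B

theorem Config.Bounded.put {s s' : Config} (hs : s.Bounded (2 ^ w)) {r v : ℕ}
    (h : s.put w r v = some s') : s'.Bounded (2 ^ w) := by
  unfold Config.put at h
  split_ifs at h with hv
  cases h
  refine ⟨fun x => ?_, hs.2⟩
  by_cases hx : x = r
  · subst hx; simpa using hv
  · simpa [Function.update_of_ne hx] using hs.1 x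

theorem Config.Bounded.exec {s s' : Config} (hs : s.Bounded (2 ^ w)) {i : Instr}
    (h : exec w ω s i = some s') : s'.Bounded (2 ^ w) := by
  cases i with
  | store a b =>
    cases h
    refine ⟨hs.1, fun x => ?_⟩
    by_cases hx : x = s.reg a
    · subst hx; simpa using hs.1 b
    · simpa [Function.update_of_ne hx] using hs.2 x
  | jump t => cases h; exact hs
  | jumpNonzero a t => cases h; exact hs
  | flip r => exact Config.Bounded.put (s := { s with coins := s.coins + 1 }) hs h
  | _ => exact hs.put h

theorem Config.Bounded.run {t : ℕ} {s s' : Config} (hs : s.Bounded (2 ^ w))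
    (h : run p w ω t s = some s') : s'.Bounded (2 ^ w) := by
  induction t generalizing s with
  | zero => cases h; exact hs
  | succ t ih =>
    obtain ⟨s₁, h₁, h₂⟩ := Option.bind_eq_some_iff.1 h
    obtain ⟨i, -, hi⟩ := Option.bind_eq_some_iff.1 h₁
    exact ih (hs.exec hi) h₂

/-! ### Code inside a larger program -/

/-- The instructions `l` are found in program `q` from position `off` on. -/
def CodeAt (q : Program) (off : ℕ) (l : List Instr) : Prop :=
  ∀ i < l.length, q[off + i]? = l[i]?

theorem CodeAt.left {off : ℕ} {l l' : List Instr} (h : CodeAt q off (l ++ l')) :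
    CodeAt q off l := fun i hi => by
  rw [h i (by simp; omega), List.getElem?_append_left hi]

theorem CodeAt.right {off : ℕ} {l l' : List Instr} (h : CodeAt q off (l ++ l')) :
    CodeAt q (off + l.length) l' := fun i hi => by
  rw [Nat.add_assoc, h _ (by simp; omega), List.getElem?_append_right (by omega)]
  congr 1; omega

theorem CodeAt.head {off : ℕ} {i : Instr} {l : List Instr} (h : CodeAt q off (i :: l)) :
    q[off]? = some i := by
  simpa using h 0 (by simp)

theorem CodeAt.tail {off : ℕ} {i : Instr} {l : List Instr} (h : CodeAt q off (i :: l)) :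
    CodeAt q (off + 1) l := CodeAt.right (l := [i]) h

theorem CodeAt.append (a l b : List Instr) : CodeAt (a ++ l ++ b) a.length l := fun i hi => by
  rw [List.getElem?_append_left (by simp; omega), List.getElem?_append_right (by omega)]
  congr 1; omega

/-- The instruction, with jump targets moved by `off`; jumps out of a program of length `len` are
redirected to the position immediately after it. -/
def Instr.relocate (off len : ℕ) : Instr → Instr
  | .jump t => .jump (off + min t len)
  | .jumpNonzero a t => .jumpNonzero a (off + min t len)
  | i => i

/-- The program, moved to position `off`. -/
def Program.relocate (p : Program) (off : ℕ) : Program :=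
  p.map (Instr.relocate off p.length)

/-- The configuration in which a program of length `len` that was moved to `off` is, when the
original program is in configuration `s`. -/
def Config.relocate (off len : ℕ) (s : Config) : Config :=
  { s with pc := off + min s.pc len }

theorem step_relocate {off : ℕ} (hq : CodeAt q off (p.relocate off)) {s s' : Config}
    (h : step p w ω s = some s') :
    step q w ω (s.relocate off p.length) = some (s'.relocate off p.length) := by
  obtain ⟨i, hi, hs⟩ := Option.bind_eq_some_iff.1 h
  obtain ⟨hlt, -⟩ := List.getElem?_eq_some_iff.1 hi
  have hi' : q[(s.relocate off p.length).pc]? = some (i.relocate off p.length) := by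
    have := hq s.pc (by simpa [Program.relocate] using hlt)
    simpa [Config.relocate, min_eq_left hlt.le, Program.relocate, hi] using this
  have hput : ∀ {x x' : Config} {r v : ℕ}, x.pc = s.pc → x.put w r v = some x' →
      (x.relocate off p.length).put w r v = some (x'.relocate off p.length) := by
    intro x x' r v hx hx'
    unfold Config.put at hx' ⊢
    split_ifs at hx' ⊢
    cases hx'
    simp only [Config.relocate, Option.some.injEq, Config.mk.injEq, and_true]
    rw [hx]; omega
  refine Option.bind_eq_some_iff.2 ⟨_, hi', ?_⟩
  cases i with
  | store a b =>
    cases hs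
    simp only [Instr.relocate, exec, Config.relocate, Option.some.injEq, Config.mk.injEq, and_true]
    omega
  | jump t => cases hs; rfl
  | jumpNonzero a t =>
    cases hs
    simp only [Instr.relocate, exec, Config.relocate, Option.some.injEq, Config.mk.injEq, and_true]
    by_cases ha : s.reg a = 0
    · simp only [ha, if_true]; omega
    · simp only [ha, if_false]
  | flip r => exact hput (x := { s with coins := s.coins + 1 }) rfl hs
  | _ => exact hput rfl hs

theorem run_relocate {off : ℕ} (hq : CodeAt q off (p.relocate off)) {t : ℕ} {s s' : Config}
    (h : run p w ω t s = some s') :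
    run q w ω t (s.relocate off p.length) = some (s'.relocate off p.length) := by
  induction t generalizing s with
  | zero => cases h; rfl
  | succ t ih =>
    obtain ⟨s₁, h₁, h₂⟩ := Option.bind_eq_some_iff.1 h
    exact Option.bind_eq_some_iff.2 ⟨_, step_relocate hq h₁, ih h₂⟩

theorem flip_mem_relocate {off r : ℕ} : Instr.flip r ∈ p.relocate off ↔ Instr.flip r ∈ p := by
  simp only [Program.relocate, List.mem_map]
  constructor
  · rintro ⟨i, hi, h⟩
    cases i <;> simp_all [Instr.relocate]
  · exact fun h => ⟨_, h, rfl⟩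

/-- Set the registers `a, a + 1, …, a + m - 1` to `0`. -/
def clearCode : ℕ → ℕ → List Instr
  | _, 0 => []
  | a, m + 1 => .const a 0 :: clearCode (a + 1) m

@[simp] theorem length_clearCode (a m : ℕ) : (clearCode a m).length = m := by
  induction m generalizing a <;> simp [clearCode, *]

theorem flip_notMem_clearCode (r a m : ℕ) : Instr.flip r ∉ clearCode a m := by
  induction m generalizing a <;> simp [clearCode, *]

theorem run_clearCode {off a m : ℕ} (hq : CodeAt q off (clearCode a m)) {reg mem : ℕ → ℕ}
    {coins : ℕ} (hreg : ∀ r, r < a ∨ a + m ≤ r → reg r = 0) :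
    run q w ω m ⟨off, reg, mem, coins⟩ = some ⟨off + m, fun _ => 0, mem, coins⟩ := by
  induction m generalizing off a reg with
  | zero =>
    have : reg = fun _ => 0 := funext fun r => hreg r (by omega)
    simp [run, this]
  | succ m ih =>
    have h₁ : step q w ω ⟨off, reg, mem, coins⟩ =
        some ⟨off + 1, Function.update reg a 0, mem, coins⟩ := by
      simp [step, hq.head, exec, Config.put]
    simp only [run, h₁, Option.bind_some]
    rw [ih hq.tail]
    · simp [Nat.add_assoc, Nat.add_comm 1]
    · intro r hr
      by_cases hra : r = a
      · simp [hra]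
      · rw [Function.update_of_ne hra]
        exact hreg r (by omega)

/-! ### Expressions -/

/-- The operations whose results are bounded by a polynomial in the operands. -/
def BinOp.IsArith : BinOp → Prop
  | .add | .sub | .mul | .div | .mod | .lt | .eq => True
  | _ => False

theorem BinOp.IsArith.eval_lt {o : BinOp} (ho : o.IsArith) {x y a b : ℕ} (ha : 2 ≤ a) (hb : 2 ≤ b)
    (hx : x < a) (hy : y < b) : o.eval x y < a * b := by
  have h₁ : x < a * b := by nlinarith
  cases o with
  | add => simp only [BinOp.eval]; nlinarith
  | sub => exact (Nat.sub_le _ _).trans_lt h₁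
  | mul => simp only [BinOp.eval]; nlinarith [Nat.mul_le_mul hx hy]
  | div => exact (Nat.div_le_self _ _).trans_lt h₁
  | mod => exact (Nat.mod_le _ _).trans_lt h₁
  | lt => simp only [BinOp.eval]; split_ifs <;> nlinarith
  | eq => simp only [BinOp.eval]; split_ifs <;> nlinarith
  | _ => exact ho.elim

/-- Expressions in four variables. -/
inductive Expr
  | const (v : ℕ)
  | var (r : Fin 4)
  | op (o : BinOp) (ho : o.IsArith) (a b : Expr)
  | load (a : Expr)

/-- The values of the four variables, and the content of the memory. -/
structure Store where
  var : Fin 4 → ℕ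
  mem : ℕ → ℕ

/-- All variables and memory cells hold numbers below `B`. -/
def Store.Bounded (B : ℕ) (σ : Store) : Prop :=
  (∀ r, σ.var r < B) ∧ ∀ a, σ.mem a < B

namespace Expr

/-- The value of an expression. -/
def eval (σ : Store) : Expr → ℕ
  | const v => v
  | var r => σ.var r
  | op o _ a b => o.eval (a.eval σ) (b.eval σ)
  | load a => σ.mem (a.eval σ)

/-- A measure of the size of an expression, and of the values that occur in its evaluation. -/
def size : Expr → ℕ
  | const v => v + 1
  | var _ => 1
  | op _ _ a b => a.size + b.size
  | load a => a.size

theorem one_le_size (e : Expr) : 1 ≤ e.size := by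
  induction e <;> simp only [size] <;> omega

theorem eval_lt {B : ℕ} (hB : 2 ≤ B) {σ : Store} (hσ : σ.Bounded B) (e : Expr) :
    e.eval σ < B ^ e.size := by
  have hself : ∀ e : Expr, B ≤ B ^ e.size := fun e =>
    Nat.le_self_pow (Nat.one_le_iff_ne_zero.1 e.one_le_size) B
  induction e with
  | const v =>
    exact (Nat.lt_pow_self (by omega : 1 < B)).trans_le
      (Nat.pow_le_pow_right (by omega) (Nat.le_succ v))
  | var r => simpa [eval, size] using hσ.1 r
  | op o ho a b iha ihb =>
    rw [size, pow_add]
    exact ho.eval_lt (hB.trans (hself a)) (hB.trans (hself b)) iha ihb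
  | load a => exact (hσ.2 _).trans_le (hself a)

/-- Code that computes the value of an expression into register `t`, with the registers after `t`
as work space. -/
def compile : Expr → ℕ → List Instr
  | const v, t => [.const t v]
  | var r, t => [.op .or t r r]
  | op o _ a b, t => a.compile t ++ b.compile (t + 1) ++ [.op o t t (t + 1)]
  | load a, t => a.compile t ++ [.load t t]

theorem flip_notMem_compile (r : ℕ) (e : Expr) (t : ℕ) : Instr.flip r ∉ e.compile t := by
  induction e generalizing t <;> simp [compile, *]

theorem run_compile {B : ℕ} (hB : 2 ≤ B) {σ : Store} (hσ : σ.Bounded B) (e : Expr) {off t : ℕ}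
    (ht : 4 ≤ t) (hq : CodeAt q off (e.compile t)) (hw : B ^ e.size ≤ 2 ^ w) {reg : ℕ → ℕ}
    {coins : ℕ} (hreg : ∀ r : Fin 4, reg r = σ.var r) :
    ∃ reg', run q w ω (e.compile t).length ⟨off, reg, σ.mem, coins⟩ =
        some ⟨off + (e.compile t).length, reg', σ.mem, coins⟩ ∧
      reg' t = e.eval σ ∧ ∀ r, r < t ∨ t + e.size ≤ r → reg' r = reg r := by
  have hev := (e.eval_lt hB hσ).trans_le hw
  have hput : ∀ {off : ℕ} {reg : ℕ → ℕ} {i : Instr}, q[off]? = some i →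
      exec w ω ⟨off, reg, σ.mem, coins⟩ i =
        Config.put w ⟨off, reg, σ.mem, coins⟩ t (e.eval σ) →
      run q w ω 1 ⟨off, reg, σ.mem, coins⟩ =
        some ⟨off + 1, Function.update reg t (e.eval σ), σ.mem, coins⟩ := by
    intro off reg i hi hx
    simp [run_one, step, hi, hx, Config.put, hev]
  have hpow : ∀ {a b : ℕ}, a ≤ b → B ^ b ≤ 2 ^ w → B ^ a ≤ 2 ^ w := fun h h' =>
    (Nat.pow_le_pow_right (by omega) h).trans h'
  induction e generalizing off t reg with
  | const v =>
    exact ⟨_, hput hq.head rfl, by simp, fun r hr => Function.update_of_ne (by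
      simp only [size] at hr; omega) _ _⟩
  | var x =>
    refine ⟨_, hput hq.head ?_, by simp, fun r hr => Function.update_of_ne (by
      simp only [size] at hr; omega) _ _⟩
    simp [exec, eval, BinOp.eval, hreg]
  | load a ih =>
    simp only [compile, size, List.length_append, List.length_cons, List.length_nil] at *
    obtain ⟨reg₁, h₁, h₁t, h₁r⟩ := ih ht hq.left hw hreg ((a.eval_lt hB hσ).trans_le hw)
      (by
        intro off reg i hi hx
        simp [run_one, step, hi, hx, Config.put, (a.eval_lt hB hσ).trans_le hw])
    refine ⟨_, run_trans h₁ (hput hq.right.head (by simp [exec, eval, h₁t])), by simp,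
      fun r hr => ?_⟩
    rw [Function.update_of_ne (by have := a.one_le_size; omega), h₁r r hr]
  | op o ho a b iha ihb =>
    simp only [compile, size, List.length_append, List.length_cons, List.length_nil] at *
    have hwa := hpow (Nat.le_add_right _ _) hw
    have hwb := hpow (Nat.le_add_left _ _) hw
    have ha := a.one_le_size
    obtain ⟨reg₁, h₁, h₁t, h₁r⟩ := iha ht hq.left.left hwa hreg
      ((a.eval_lt hB hσ).trans_le hwa) (by
        intro off reg i hi hx
        simp [run_one, step, hi, hx, Config.put, (a.eval_lt hB hσ).trans_le hwa])
    obtain ⟨reg₂, h₂, h₂t, h₂r⟩ := ihb (reg := reg₁) (t := t + 1) (by omega) hq.left.right hwb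
      (fun r => by rw [h₁r r (by omega), hreg]) ((b.eval_lt hB hσ).trans_le hwb) (by
        intro off reg i hi hx
        simp [run_one, step, hi, hx, Config.put, (b.eval_lt hB hσ).trans_le hwb])
    have hq₃ := hq.right.head
    rw [List.length_append, ← Nat.add_assoc] at hq₃
    have h₃ := run_trans (run_trans h₁ h₂)
      (hput hq₃ (by simp [exec, eval, h₂t, h₂r t (by omega), h₁t]))
    simp only [Nat.add_assoc] at h₃ ⊢
    refine ⟨_, h₃, by simp, fun r hr => ?_⟩
    rw [Function.update_of_ne (by omega), h₂r r (by omega), h₁r r (by omega)]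

end Expr

/-! ### Straight-line code -/

/-- Assignments to a variable and to a memory cell. -/
inductive Stmt
  | assign (r : Fin 4) (e : Expr)
  | store (a e : Expr)

namespace Stmt

/-- The effect of a statement. -/
def eval (σ : Store) : Stmt → Store
  | assign r e => ⟨Function.update σ.var r (e.eval σ), σ.mem⟩
  | store a e => ⟨σ.var, Function.update σ.mem (a.eval σ) (e.eval σ)⟩

/-- A bound on the sizes of the expressions of a statement. -/
def size : Stmt → ℕ
  | assign _ e => e.size
  | store a e => a.size + e.size

/-- Code for a statement. -/
def compile : Stmt → List Instr
  | assign r e => e.compile 4 ++ [.op .or r 4 4]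
  | store a e => a.compile 4 ++ e.compile 5 ++ [.store 4 5]

theorem flip_notMem_compile (r : ℕ) (c : Stmt) : Instr.flip r ∉ c.compile := by
  cases c <;> simp [compile, Expr.flip_notMem_compile]

end Stmt

/-- Started at position `off` with variables and memory `σ`, program `q` arrives after `t` steps
at `off'` with `σ'`, and it has not tossed coins or changed any register from `R` on. -/
def Exec (q : Program) (w : ℕ) (ω : ℕ → Bool) (R off : ℕ) (σ : Store) (t off' : ℕ) (σ' : Store) :
    Prop :=
  ∀ (reg : ℕ → ℕ) (coins : ℕ), (∀ r : Fin 4, reg r = σ.var r) →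
    ∃ reg', run q w ω t ⟨off, reg, σ.mem, coins⟩ = some ⟨off', reg', σ'.mem, coins⟩ ∧
      (∀ r : Fin 4, reg' r = σ'.var r) ∧ ∀ r, R ≤ r → reg' r = reg r

variable {R off off' off'' t t' : ℕ} {σ σ' σ'' : Store}

theorem Exec.refl : Exec q w ω R off σ 0 off σ := fun reg _ h => ⟨reg, rfl, h, fun _ _ => rfl⟩

theorem Exec.trans (h : Exec q w ω R off σ t off' σ') (h' : Exec q w ω R off' σ' t' off'' σ'') :
    Exec q w ω R off σ (t + t') off'' σ'' := fun reg coins hreg => by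
  obtain ⟨reg₁, h₁, hv₁, hr₁⟩ := h reg coins hreg
  obtain ⟨reg₂, h₂, hv₂, hr₂⟩ := h' reg₁ coins hv₁
  exact ⟨reg₂, run_trans h₁ h₂, hv₂, fun r hr => (hr₂ r hr).trans (hr₁ r hr)⟩

theorem Stmt.exec_compile {B : ℕ} (hB : 2 ≤ B) (hσ : σ.Bounded B) (c : Stmt)
    (hq : CodeAt q off c.compile) (hw : B ^ c.size ≤ 2 ^ w) (hR : c.size + 5 ≤ R) :
    Exec q w ω R off σ c.compile.length (off + c.compile.length) (c.eval σ) := by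
  intro reg coins hreg
  cases c with
  | assign x e =>
    simp only [compile, size, List.length_append, List.length_cons, List.length_nil] at *
    obtain ⟨reg₁, h₁, h₁t, h₁r⟩ := e.run_compile hB hσ le_rfl hq.left hw (ω := ω)
      (coins := coins) hreg
    have hx : e.eval σ < 2 ^ w := (e.eval_lt hB hσ).trans_le hw
    refine ⟨Function.update reg₁ x (e.eval σ), run_trans h₁ ?_, fun r => ?_, fun r hr => ?_⟩
    · simp [run_one, step, hq.right.head, WordRAM.exec, h₁t, BinOp.eval, Config.put, hx, eval,
        Nat.add_assoc]
    · by_cases hr : r = x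
      · simp [hr, eval]
      · rw [Function.update_of_ne (by simpa [Fin.ext_iff] using hr), h₁r r (by omega), hreg]
        simp [eval, Function.update_of_ne hr]
    · rw [Function.update_of_ne (by omega), h₁r r (by omega)]
  | store a e =>
    simp only [compile, size, List.length_append, List.length_cons, List.length_nil] at *
    have hpow : ∀ {a b : ℕ}, a ≤ b → B ^ b ≤ 2 ^ w → B ^ a ≤ 2 ^ w := fun h h' =>
      (Nat.pow_le_pow_right (by omega) h).trans h'
    obtain ⟨reg₁, h₁, h₁t, h₁r⟩ := a.run_compile hB hσ le_rfl hq.left.left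
      (hpow (Nat.le_add_right _ _) hw) (ω := ω) (coins := coins) hreg
    obtain ⟨reg₂, h₂, h₂t, h₂r⟩ := e.run_compile hB hσ (by omega : 4 ≤ 5) hq.left.right
      (hpow (Nat.le_add_left _ _) hw) (ω := ω) (coins := coins) (reg := reg₁)
      (fun r => by rw [h₁r r (by omega), hreg])
    have hq₃ := hq.right.head
    rw [List.length_append, ← Nat.add_assoc] at hq₃
    refine ⟨reg₂, run_trans (run_trans h₁ h₂) ?_, fun r => ?_, fun r hr => ?_⟩
    · simp [run_one, step, hq₃, WordRAM.exec, h₂t, h₂r 4 (by omega), h₁t, eval, ← Nat.add_assoc]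
    · rw [h₂r r (by omega), h₁r r (by omega), hreg]; rfl
    · rw [h₂r r (by omega), h₁r r (by omega)]

/-- A sequence of statements. -/
abbrev Block := List Stmt

namespace Block

/-- The effect of a sequence of statements. -/
def eval : Block → Store → Store
  | [], σ => σ
  | c :: l, σ => eval l (c.eval σ)

/-- A bound on the sizes of the expressions of a sequence of statements. -/
def size : Block → ℕ
  | [] => 0
  | c :: l => c.size + size l

/-- Code for a sequence of statements. -/
def compile : Block → List Instr
  | [] => []
  | c :: l => c.compile ++ compile l

/-- Numbers stay below `B`. -/
def Safe (B : ℕ) : Block → Store → Prop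
  | [], _ => True
  | c :: l, σ => σ.Bounded B ∧ Safe B l (c.eval σ)

theorem flip_notMem_compile (r : ℕ) (l : Block) : Instr.flip r ∉ compile l := by
  induction l <;> simp [compile, Stmt.flip_notMem_compile, *]

theorem exec_compile {B : ℕ} (hB : 2 ≤ B) (l : Block) (hl : Safe B l σ)
    (hq : CodeAt q off (compile l)) (hw : B ^ size l ≤ 2 ^ w) (hR : size l + 5 ≤ R) :
    Exec q w ω R off σ (compile l).length (off + (compile l).length) (eval l σ) := by
  have hpow : ∀ {a b : ℕ}, a ≤ b → B ^ b ≤ 2 ^ w → B ^ a ≤ 2 ^ w := fun h h' =>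
    (Nat.pow_le_pow_right (by omega) h).trans h'
  induction l generalizing off σ with
  | nil => exact Exec.refl
  | cons c l ih =>
    simp only [compile, size, List.length_append] at *
    have h := (c.exec_compile hB hl.1 hq.left (hpow (Nat.le_add_right _ _) hw)
      (by omega)).trans (ω := ω) (ih hl.2 hq.right (hpow (Nat.le_add_left _ _) hw) (by omega))
    rwa [Nat.add_assoc] at h

end Block

/-! ### Loops -/

/-- A sequence of statements, or a loop that repeats such a sequence until variable `r` is `0`. -/
inductive Cmd
  | block (l : Block)
  | loop (r : Fin 4) (l : Block)

namespace Cmd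

/-- Code for a command, to be used at position `off`. -/
def compile (off : ℕ) : Cmd → List Instr
  | block l => l.compile
  | loop r l => l.compile ++ [.jumpNonzero r off]

/-- Code for a sequence of commands, to be used at position `off`. -/
def compileAll : ℕ → List Cmd → List Instr
  | _, [] => []
  | off, c :: cs => c.compile off ++ compileAll (off + (c.compile off).length) cs

/-- A bound on the sizes of the expressions of a sequence of commands. -/
def sizeAll : List Cmd → ℕ
  | [] => 0
  | block l :: cs => l.size + sizeAll cs
  | loop _ l :: cs => l.size + sizeAll cs

theorem flip_notMem_compileAll (r off : ℕ) (cs : List Cmd) :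
    Instr.flip r ∉ compileAll off cs := by
  induction cs generalizing off with
  | nil => simp [compileAll]
  | cons c cs ih => cases c <;> simp [compileAll, compile, Block.flip_notMem_compile, ih]

end Cmd

theorem Exec.loop {B : ℕ} (hB : 2 ≤ B) (l : Block) (r : Fin 4) (m : ℕ)
    (hl : ∀ j ≤ m, l.Safe B (l.eval^[j] σ))
    (hr : ∀ j ≤ m, (l.eval^[j + 1] σ).var r = m - j)
    (hq : CodeAt q off ((Cmd.loop r l).compile off)) (hw : B ^ l.size ≤ 2 ^ w)
    (hR : l.size + 5 ≤ R) :
    Exec q w ω R off σ ((m + 1) * (l.compile.length + 1)) (off + (l.compile.length + 1))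
      (l.eval^[m + 1] σ) := by
  induction m generalizing σ with
  | zero =>
    have h₁ := l.exec_compile hB (hl 0 le_rfl) hq.left hw hR (ω := ω)
    intro reg coins hreg
    obtain ⟨reg', h, hv, hf⟩ := h₁ reg coins hreg
    refine ⟨reg', ?_, hv, hf⟩
    rw [Nat.zero_add, Nat.one_mul]
    refine run_trans h ?_
    have h0 : reg' r = 0 := by rw [hv]; exact hr 0 le_rfl
    simp [run_one, step, hq.right.head, WordRAM.exec, h0, Nat.add_assoc]
  | succ m ih =>
    have h₁ : Exec q w ω R off σ (l.compile.length + 1) off (l.eval σ) := by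
      intro reg coins hreg
      obtain ⟨reg', h, hv, hf⟩ :=
        l.exec_compile hB (hl 0 (Nat.zero_le _)) hq.left hw hR (ω := ω) reg coins hreg
      refine ⟨reg', run_trans h ?_, hv, hf⟩
      have h0 : reg' r = m + 1 := by rw [hv]; exact hr 0 (Nat.zero_le _)
      simp [run_one, step, hq.right.head, WordRAM.exec, h0]
    have h₂ := h₁.trans (ih (σ := l.eval σ) (fun j hj => hl (j + 1) (by omega))
      (fun j hj => (hr (j + 1) (by omega)).trans (by omega)))
    rwa [show l.compile.length + 1 + (m + 1) * (l.compile.length + 1) =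
      (m + 1 + 1) * (l.compile.length + 1) by ring] at h₂

/-- `Evaluates B cs σ t σ'`: the sequence of commands `cs` turns `σ` into `σ'` in `t` steps, and
all numbers stay below `B`. -/
inductive Evaluates (B : ℕ) : List Cmd → Store → ℕ → Store → Prop
  | nil (σ : Store) : Evaluates B [] σ 0 σ
  | block {l : Block} {cs : List Cmd} {σ σ' : Store} {t : ℕ} (hl : l.Safe B σ)
      (h : Evaluates B cs (l.eval σ) t σ') :
      Evaluates B (.block l :: cs) σ (l.compile.length + t) σ'
  | loop {r : Fin 4} {l : Block} {cs : List Cmd} {σ σ' : Store} {t : ℕ} (m : ℕ)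
      (hl : ∀ j ≤ m, l.Safe B (l.eval^[j] σ)) (hr : ∀ j ≤ m, (l.eval^[j + 1] σ).var r = m - j)
      (h : Evaluates B cs (l.eval^[m + 1] σ) t σ') :
      Evaluates B (.loop r l :: cs) σ ((m + 1) * (l.compile.length + 1) + t) σ'

theorem Evaluates.exec {B : ℕ} (hB : 2 ≤ B) {cs : List Cmd} (h : Evaluates B cs σ t σ')
    (hq : CodeAt q off (Cmd.compileAll off cs)) (hw : B ^ Cmd.sizeAll cs ≤ 2 ^ w)
    (hR : Cmd.sizeAll cs + 5 ≤ R) :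
    Exec q w ω R off σ t (off + (Cmd.compileAll off cs).length) σ' := by
  have hpow : ∀ {a b : ℕ}, a ≤ b → B ^ b ≤ 2 ^ w → B ^ a ≤ 2 ^ w := fun h h' =>
    (Nat.pow_le_pow_right (by omega) h).trans h'
  induction h generalizing off with
  | nil σ => exact Exec.refl
  | block hl h ih =>
    simp only [Cmd.compileAll, Cmd.sizeAll, Cmd.compile, List.length_append] at *
    rw [← Nat.add_assoc]
    exact (Block.exec_compile hB _ hl hq.left (hpow (Nat.le_add_right _ _) hw) (by omega)).trans
      (ih hq.right (hpow (Nat.le_add_left _ _) hw) (by omega))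
  | @loop r l cs σ σ' t m hl hr h ih =>
    have hlen : ((Cmd.loop r l).compile off).length = l.compile.length + 1 := by
      simp [Cmd.compile]
    simp only [Cmd.compileAll, Cmd.sizeAll, List.length_append] at *
    rw [← Nat.add_assoc]
    have h₁ := Exec.loop hB l r m hl hr hq.left (hpow (Nat.le_add_right _ _) hw)
      (by omega : l.size + 5 ≤ R) (ω := ω)
    rw [← hlen] at h₁ ⊢
    exact h₁.trans (ih hq.right (hpow (Nat.le_add_left _ _) hw) (by omega))

end WordRAM

/-! ### Cyclic windows -/

section Windows

variable {n u k : ℕ}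

theorem mem_cyclicWindow_id (hu : u ≤ k) {i x : Fin k} :
    x ∈ cyclicWindow u id i ↔
      ((i : ℕ) ≤ x ∧ (x : ℕ) < i + u) ∨ ((x : ℕ) < i ∧ (x : ℕ) + k < i + u) := by
  have hmod : ∀ j < u, ((i : ℕ) + j) % k = if (i : ℕ) + j < k then (i : ℕ) + j else i + j - k := by
    intro j hj
    split_ifs with h
    · exact Nat.mod_eq_of_lt h
    · rw [Nat.mod_eq_sub_mod (by omega), Nat.mod_eq_of_lt (by omega)]
  simp only [cyclicWindow, Finset.mem_image, Finset.mem_univ, true_and, id, Fin.ext_iff]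
  constructor
  · rintro ⟨j, hj⟩
    rw [hmod j j.2] at hj
    split_ifs at hj <;> omega
  · rintro (h | h)
    · refine ⟨⟨x - i, by omega⟩, ?_⟩
      rw [hmod _ (by simp; omega), if_pos (by simp; omega)]
      simp; omega
    · refine ⟨⟨x + k - i, by omega⟩, ?_⟩
      rw [hmod _ (by simp; omega), if_neg (by simp; omega)]
      simp; omega

theorem cyclicWindow_eq_image (v : Fin k → Fin n) (i : Fin k) :
    cyclicWindow u v i = (cyclicWindow u id i).image v := by
  simp [cyclicWindow, Finset.image_image, Function.comp_def]

theorem cyclicWindow_id_injective (h1 : 1 ≤ u) (hu : u < k) :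
    Function.Injective (cyclicWindow u (id : Fin k → Fin k)) := by
  intro i i' h
  by_contra hne
  have hne' : (i : ℕ) ≠ i' := fun h => hne (Fin.ext h)
  have hi := mem_cyclicWindow_id hu.le (i := i') (x := i)
  rw [← h, mem_cyclicWindow_id hu.le] at hi
  obtain ⟨x, hx⟩ : ∃ x : Fin k, (x : ℕ) = if (i : ℕ) = 0 then k - 1 else i - 1 :=
    ⟨⟨if (i : ℕ) = 0 then k - 1 else i - 1, by split_ifs <;> omega⟩, rfl⟩
  have hx' := mem_cyclicWindow_id hu.le (i := i') (x := x)
  rw [← h, mem_cyclicWindow_id hu.le] at hx'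
  split_ifs at hx <;> omega

theorem card_cyclicWindow_id (hu : u ≤ k) (i : Fin k) :
    (cyclicWindow u (id : Fin k → Fin k) i).card = u := by
  rw [cyclicWindow, Finset.card_image_of_injective, Finset.card_univ, Fintype.card_fin]
  intro j j' h
  simp only [id, Fin.mk.injEq] at h
  have := Nat.ModEq.add_left_cancel' (i : ℕ) h
  exact Fin.ext (Nat.ModEq.eq_of_lt_of_lt this (by omega) (by omega))

theorem exists_mem_cyclicWindow_id (hu : u ≤ k) (hk : k < 2 * u) (a b : Fin k) :
    ∃ i : Fin k, a ∈ cyclicWindow u id i ∧ b ∈ cyclicWindow u id i := by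
  simp only [mem_cyclicWindow_id hu]
  by_cases h : (a : ℕ) ≤ b
  · by_cases h' : (b : ℕ) < a + u
    · exact ⟨a, by omega⟩
    · exact ⟨b, by omega⟩
  · by_cases h' : (a : ℕ) < b + u
    · exact ⟨b, by omega⟩
    · exact ⟨a, by omega⟩

/-- The number of windows of `u` cyclically consecutive elements that contain `a` and `b`. -/
def windowCount (u : ℕ) (a b : Fin k) : ℕ :=
  (Finset.univ.filter fun i : Fin k => a ∈ cyclicWindow u id i ∧ b ∈ cyclicWindow u id i).card

/-- The factor by which the weight of a pair is multiplied in each window, so that all pairs have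
the same total factor `k!`. -/
def windowFactor (u : ℕ) (a b : Fin k) : ℕ := k.factorial / windowCount u a b

theorem windowCount_pos (hu : u ≤ k) (hk : k < 2 * u) (a b : Fin k) : 0 < windowCount u a b := by
  obtain ⟨i, hi⟩ := exists_mem_cyclicWindow_id hu hk a b
  exact Finset.card_pos.2 ⟨i, by simpa using hi⟩

theorem windowCount_dvd (hu : u ≤ k) (hk : k < 2 * u) (a b : Fin k) :
    windowCount u a b ∣ k.factorial := by
  refine Nat.dvd_factorial (windowCount_pos hu hk a b) ?_
  simpa [windowCount] using Finset.card_filter_le (Finset.univ : Finset (Fin k))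
    fun i => a ∈ cyclicWindow u id i ∧ b ∈ cyclicWindow u id i

theorem windowCount_mul_windowFactor (hu : u ≤ k) (hk : k < 2 * u) (a b : Fin k) :
    windowCount u a b * windowFactor u a b = k.factorial :=
  Nat.mul_div_cancel' (windowCount_dvd hu hk a b)

theorem windowFactor_pos (hu : u ≤ k) (hk : k < 2 * u) (a b : Fin k) : 0 < windowFactor u a b :=
  Nat.div_pos (Nat.le_of_dvd (Nat.factorial_pos k) (windowCount_dvd hu hk a b))
    (windowCount_pos hu hk a b)

theorem windowFactor_le (u : ℕ) (a b : Fin k) : windowFactor u a b ≤ k.factorial :=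
  Nat.div_le_self _ _

theorem windowCount_comp (h1 : 1 ≤ u) (hu : u < k) {π : Fin k → Fin k}
    (hπ : Function.Injective π)
    (hw : ∀ i, ∃ s, (cyclicWindow u id i).image π = cyclicWindow u (id : Fin k → Fin k) s)
    (a b : Fin k) : windowCount u (π a) (π b) = windowCount u a b := by
  choose s hs using hw
  have hsi : Function.Injective s := fun i i' h => by
    apply cyclicWindow_id_injective h1 hu
    apply Finset.image_injective hπ
    rw [hs, hs, h]
  symm
  refine Finset.card_equiv (Equiv.ofBijective s (Finite.injective_iff_bijective.1 hsi)) fun i => ?_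
  simp [← hs, hπ.eq_iff]

theorem sum_cyclicWindow_windowFactor (h1 : 1 ≤ u) (hu : u < k) (hk : k < 2 * u)
    {π : Fin k → Fin k} (hπ : Function.Injective π)
    (hw : ∀ i, ∃ s, (cyclicWindow u id i).image π = cyclicWindow u (id : Fin k → Fin k) s)
    (f : Fin k → Fin k → ℕ) :
    ∑ i, ∑ a ∈ cyclicWindow u (id : Fin k → Fin k) i, ∑ b ∈ cyclicWindow u id i,
        windowFactor u (π a) (π b) * f a b = k.factorial * ∑ a, ∑ b, f a b := by
  have h : ∀ i : Fin k, ∑ a ∈ cyclicWindow u (id : Fin k → Fin k) i, ∑ b ∈ cyclicWindow u id i,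
      windowFactor u (π a) (π b) * f a b = ∑ a, ∑ b,
        if a ∈ cyclicWindow u id i ∧ b ∈ cyclicWindow u id i then
          windowFactor u (π a) (π b) * f a b else 0 := by
    intro i
    conv_lhs => rw [← Finset.univ_inter (cyclicWindow u id i), ← Finset.sum_ite_mem]
    refine Finset.sum_congr rfl fun a _ => ?_
    by_cases ha : a ∈ cyclicWindow u id i <;> simp [ha, Finset.sum_ite_mem]
  simp only [h]
  rw [Finset.sum_comm, Finset.mul_sum]
  refine Finset.sum_congr rfl fun a _ => ?_
  rw [Finset.sum_comm, Finset.mul_sum]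
  refine Finset.sum_congr rfl fun b _ => ?_
  rw [← Finset.sum_filter, Finset.sum_const, smul_eq_mul, ← mul_assoc]
  congr 1
  rw [← windowCount_mul_windowFactor hu.le hk (π a) (π b), windowCount_comp h1 hu hπ hw]
  rfl

end Windows

/-! ### The hypergraph of a graph -/

namespace WeightedGraph

variable {n u k : ℕ} {B B' : ℝ}

open Classical in
/-- The entries of the weighted adjacency matrix. -/
noncomputable def entry (G : WeightedGraph n B) (x y : Fin n) : ℕ :=
  if G.graph.Adj x y then G.weight s(x, y) else 0

theorem entry_pos {G : WeightedGraph n B} {x y : Fin n} : 0 < G.entry x y ↔ G.graph.Adj x y := by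
  unfold entry
  split_ifs with h
  · exact iff_of_true (G.one_le_weight _ h) h
  · simp [h]

theorem entry_comm (G : WeightedGraph n B) (x y : Fin n) : G.entry x y = G.entry y x := by
  by_cases h : G.graph.Adj x y
  · simp [entry, h, h.symm, Sym2.eq_swap (a := x)]
  · simp [entry, h, mt (G.graph.adj_comm y x).1 h]

theorem entry_le (hB : 0 ≤ B) (G : WeightedGraph n B) (x y : Fin n) : (G.entry x y : ℝ) ≤ B := by
  unfold entry
  split_ifs with h
  · exact G.weight_le _ h
  · simpa using hB

theorem sum_entry_eq (G : WeightedGraph n B) {S : Finset (Fin n)} (hS : G.graph.IsClique S) :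
    ∑ x ∈ S, ∑ y ∈ S, G.entry x y = 2 * G.cliqueWeight S := by
  have hlt : ∑ e ∈ S.offDiag with e.1 < e.2, G.entry e.1 e.2 = G.cliqueWeight S := by
    rw [cliqueWeight, Finset.sum_sym2_filter_not_isDiag]
    refine Finset.sum_congr rfl fun e he => ?_
    simp only [Finset.mem_filter, Finset.mem_offDiag] at he
    exact if_pos (hS he.1.1 he.1.2.1 he.1.2.2)
  have hgt : ∑ e ∈ S.offDiag with ¬ e.1 < e.2, G.entry e.1 e.2 = G.cliqueWeight S := by
    rw [← hlt]
    refine Finset.sum_bij' (fun e _ => e.swap) (fun e _ => e.swap) ?_ ?_ (by simp) (by simp) ?_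
    · rintro ⟨a, b⟩ h
      simp only [Finset.mem_filter, Finset.mem_offDiag, Prod.swap, not_lt] at h ⊢
      exact ⟨⟨h.1.2.1, h.1.1, h.1.2.2.symm⟩, lt_of_le_of_ne h.2 h.1.2.2.symm⟩
    · rintro ⟨a, b⟩ h
      simp only [Finset.mem_filter, Finset.mem_offDiag, Prod.swap, not_lt] at h ⊢
      exact ⟨⟨h.1.2.1, h.1.1, h.1.2.2.symm⟩, h.2.le⟩
    · rintro ⟨a, b⟩ -
      exact G.entry_comm a b
  have hdiag : ∑ e ∈ S.diag, G.entry e.1 e.2 = 0 :=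
    Finset.sum_eq_zero fun e he => by
      obtain ⟨-, h⟩ := Finset.mem_diag.1 he
      simp [entry, h]
  rw [← Finset.sum_product', ← Finset.diag_union_offDiag,
    Finset.sum_union (Finset.disjoint_diag_offDiag S), hdiag,
    ← Finset.sum_filter_add_sum_filter_not S.offDiag (fun e => e.1 < e.2), hlt, hgt]
  ring

/-- The weight of a set of coloured nodes. -/
noncomputable def windowWeight (G : WeightedGraph n B) (u k : ℕ) (e : Finset (Fin (n * k))) : ℕ :=
  ∑ y ∈ e, ∑ z ∈ e, windowFactor u y.modNat z.modNat * G.entry y.divNat z.divNat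

theorem windowWeight_pos (G : WeightedGraph n B) (hu : u ≤ k) (hk : k < 2 * u)
    {e : Finset (Fin (n * k))} {y z : Fin (n * k)} (hy : y ∈ e) (hz : z ∈ e)
    (h : G.graph.Adj y.divNat z.divNat) : 0 < G.windowWeight u k e := by
  refine Finset.sum_pos' (fun _ _ => Nat.zero_le _) ⟨y, hy, ?_⟩
  exact Finset.sum_pos' (fun _ _ => Nat.zero_le _)
    ⟨z, hz, Nat.mul_pos (windowFactor_pos hu hk _ _) (entry_pos.2 h)⟩

theorem windowWeight_le (hB : 0 ≤ B) (G : WeightedGraph n B) (u k : ℕ) (e : Finset (Fin (n * k))) :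
    (G.windowWeight u k e : ℝ) ≤ e.card * (e.card * (k.factorial * B)) := by
  unfold windowWeight
  push_cast
  have h : ∀ y z : Fin (n * k), (windowFactor u y.modNat z.modNat *
      G.entry y.divNat z.divNat : ℝ) ≤ k.factorial * B := fun y z =>
    mul_le_mul (by exact_mod_cast windowFactor_le u _ _) (G.entry_le hB _ _) (by positivity)
      (by positivity)
  refine (Finset.sum_le_sum fun y _ => Finset.sum_le_sum fun z _ => h y z).trans_eq ?_
  simp

/-- The sets of `u` coloured nodes that form a clique in `G` and whose colours are cyclically
consecutive. -/
def IsWindowEdge (G : WeightedGraph n B) (u k : ℕ) (e : Finset (Fin (n * k))) : Prop :=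
  e.card = u ∧ (∃ s, e.image Fin.modNat = cyclicWindow u (id : Fin k → Fin k) s) ∧
    ∀ y ∈ e, ∀ z ∈ e, y ≠ z → G.graph.Adj y.divNat z.divNat

/-- The hypergraph whose nodes are the pairs of a node of `G` and a colour in `Fin k`. -/
noncomputable def windowHypergraph (G : WeightedGraph n B) (u k : ℕ) (B' : ℝ) (hB : 0 ≤ B)
    (h2 : 2 ≤ u) (hu : u < k) (hk : k < 2 * u) (hB' : (u * (u * (k.factorial * B)) : ℝ) ≤ B') :
    WeightedHypergraph (n * k) u B' where
  edges := {e | G.IsWindowEdge u k e}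
  card_eq _ he := he.1
  weight := G.windowWeight u k
  one_le_weight e he := by
    obtain ⟨y, hy, z, hz, hyz⟩ := Finset.one_lt_card.1 (h2.trans_eq he.1.symm)
    exact G.windowWeight_pos hu.le hk hy hz (he.2.2 y hy z hz hyz)
  weight_le e he := by
    refine (G.windowWeight_le hB u k e).trans ?_
    rwa [he.1]

section

variable {G : WeightedGraph n B} {hB : 0 ≤ B} {h2 : 2 ≤ u} {hu : u < k} {hk : k < 2 * u}
  {hB' : (u * (u * (k.factorial * B)) : ℝ) ≤ B'}

local notation "H" => G.windowHypergraph u k B' hB h2 hu hk hB'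

theorem isHypercycle_windowHypergraph {v : Fin k → Fin (n * k)} (hv : (H).IsHypercycle v) :
    Function.Injective (fun a => (v a).modNat) ∧
      (∀ a b, a ≠ b → G.graph.Adj (v a).divNat (v b).divNat) ∧
      ∀ i, ∃ s, (cyclicWindow u id i).image (fun a => (v a).modNat) =
        cyclicWindow u (id : Fin k → Fin k) s := by
  obtain ⟨hinj, he⟩ := hv
  have hmem : ∀ {a i}, a ∈ cyclicWindow u id i → v a ∈ cyclicWindow u v i := fun h => by
    rw [cyclicWindow_eq_image]; exact Finset.mem_image_of_mem v h
  refine ⟨fun a b hab => ?_, fun a b hab => ?_, fun i => ?_⟩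
  · obtain ⟨i, ha, hb⟩ := exists_mem_cyclicWindow_id hu.le hk a b
    obtain ⟨hcard, ⟨s, hs⟩, -⟩ := he i
    have : Set.InjOn Fin.modNat (cyclicWindow u v i : Set (Fin (n * k))) := by
      rw [← Finset.card_image_iff, hs, card_cyclicWindow_id hu.le, hcard]
    exact hinj (this (hmem ha) (hmem hb) hab)
  · obtain ⟨i, ha, hb⟩ := exists_mem_cyclicWindow_id hu.le hk a b
    exact (he i).2.2 _ (hmem ha) _ (hmem hb) (hinj.ne hab)
  · obtain ⟨-, ⟨s, hs⟩, -⟩ := he i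
    refine ⟨s, ?_⟩
    rw [← hs, cyclicWindow_eq_image v, Finset.image_image]
    rfl

theorem isNClique_of_isHypercycle {v : Fin k → Fin (n * k)} (hv : (H).IsHypercycle v) :
    G.graph.IsNClique k (Finset.univ.image fun a => (v a).divNat) := by
  obtain ⟨-, hadj, -⟩ := isHypercycle_windowHypergraph hv
  constructor
  · intro x hx y hy hxy
    simp only [Finset.coe_image, Finset.coe_univ, Set.image_univ, Set.mem_range] at hx hy
    obtain ⟨a, rfl⟩ := hx
    obtain ⟨b, rfl⟩ := hy
    exact hadj a b fun h => hxy (by rw [h])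
  · rw [Finset.card_image_of_injective, Finset.card_univ, Fintype.card_fin]
    intro a b hab
    by_contra hne
    exact (hadj a b hne).ne hab

theorem cycleWeight_windowHypergraph {v : Fin k → Fin (n * k)} (hv : (H).IsHypercycle v) :
    (H).cycleWeight v =
      k.factorial * (2 * G.cliqueWeight (Finset.univ.image fun a => (v a).divNat)) := by
  obtain ⟨hinj, hadj, hwin⟩ := isHypercycle_windowHypergraph hv
  rw [← G.sum_entry_eq (isNClique_of_isHypercycle hv).1]
  have hd : Function.Injective fun a => (v a).divNat := fun a b hab => by
    by_contra hne
    exact (hadj a b hne).ne hab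
  simp only [Finset.sum_image hd.injOn]
  rw [← sum_cyclicWindow_windowFactor (by omega) hu hk hinj hwin]
  refine Finset.sum_congr rfl fun i _ => ?_
  rw [cyclicWindow_eq_image]
  simp only [windowHypergraph, windowWeight, Finset.sum_image hv.1.injOn]

theorem exists_isHypercycle {S : Finset (Fin n)} (hS : G.graph.IsNClique k S) :
    ∃ v : Fin k → Fin (n * k), (H).IsHypercycle v ∧
      (Finset.univ.image fun a => (v a).divNat) = S := by
  have hdiv : ∀ (x : Fin n) (c : Fin k), (finProdFinEquiv (x, c)).divNat = x := fun x c =>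
    congrArg Prod.fst (finProdFinEquiv.symm_apply_apply (x, c))
  have hmod : ∀ (x : Fin n) (c : Fin k), (finProdFinEquiv (x, c)).modNat = c := fun x c =>
    congrArg Prod.snd (finProdFinEquiv.symm_apply_apply (x, c))
  let v : Fin k → Fin (n * k) := fun a => finProdFinEquiv (S.orderEmbOfFin hS.2 a, a)
  have hinj : Function.Injective v := fun a b h => by
    have := finProdFinEquiv.injective h
    exact (Prod.mk.inj this).2
  refine ⟨v, ⟨hinj, fun i => ⟨?_, ⟨i, ?_⟩, ?_⟩⟩, ?_⟩
  · rw [cyclicWindow_eq_image, Finset.card_image_of_injective _ hinj, card_cyclicWindow_id hu.le]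
  · rw [cyclicWindow_eq_image, Finset.image_image]
    rw [show Fin.modNat ∘ v = id from funext fun a => hmod _ _, Finset.image_id]
  · rw [cyclicWindow_eq_image]
    intro y hy z hz hyz
    obtain ⟨a, -, rfl⟩ := Finset.mem_image.1 hy
    obtain ⟨b, -, rfl⟩ := Finset.mem_image.1 hz
    simp only [v, hdiv]
    refine hS.1 (S.orderEmbOfFin_mem hS.2 a) (S.orderEmbOfFin_mem hS.2 b) fun h => hyz ?_
    rw [(S.orderEmbOfFin hS.2).injective h]
  · simp only [v, hdiv]
    exact S.image_orderEmbOfFin_univ hS.2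

theorem isMinClique_of_isMinHypercycle {v : Fin k → Fin (n * k)} (hv : (H).IsMinHypercycle v) :
    G.IsMinClique k (Finset.univ.image fun a => (v a).divNat) := by
  refine ⟨isNClique_of_isHypercycle hv.1, fun S hS => ?_⟩
  obtain ⟨v', hv', rfl⟩ := exists_isHypercycle (B' := B') (hB := hB) (h2 := h2) (hu := hu)
    (hk := hk) (hB' := hB') hS
  have h := hv.2 v' hv'
  rw [cycleWeight_windowHypergraph hv.1, cycleWeight_windowHypergraph hv'] at h
  have := Nat.le_of_mul_le_mul_left h k.factorial_pos
  omega

theorem correctAnswer_of_windowHypergraph {mem mem' : ℕ → ℕ} (h : (H).CorrectAnswer k mem)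
    (h0 : mem' 0 = mem 0) (hk' : ∀ i < k, mem' (i + 1) = mem (i + 1) / k) :
    G.CorrectAnswer k mem' := by
  rcases h with ⟨h1, v, hv, hmin⟩ | ⟨h1, hno⟩
  · refine Or.inl ⟨h0.trans h1, fun a => (v a).divNat, fun i => ?_,
      isMinClique_of_isMinHypercycle hmin⟩
    rw [hk' i i.2, hv]
    rfl
  · refine Or.inr ⟨h0.trans h1, fun S hS => ?_⟩
    obtain ⟨v, hv, -⟩ := exists_isHypercycle (B' := B') (hB := hB) (h2 := h2) (hu := hu)
      (hk := hk) (hB' := hB') hS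
    exact hno v hv

end

end WeightedGraph

namespace WordRAM

/-! ### Further expressions -/

namespace Expr

/-- Sum of two expressions. -/
abbrev add (a b : Expr) : Expr := op .add trivial a b

/-- Product of two expressions. -/
abbrev mul (a b : Expr) : Expr := op .mul trivial a b

/-- Quotient of two expressions. -/
abbrev div (a b : Expr) : Expr := op .div trivial a b

/-- Remainder of two expressions. -/
abbrev mod (a b : Expr) : Expr := op .mod trivial a b

/-- Power of an expression with a constant exponent. -/
def pow (e : Expr) : ℕ → Expr
  | 0 => const 1
  | j + 1 => mul (pow e j) e

/-- Sum of a finite family of expressions. -/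
noncomputable def sum {ι : Type*} (s : Finset ι) (f : ι → Expr) : Expr :=
  (s.toList.map f).foldr add (const 0)

/-- Product of a finite family of expressions. -/
noncomputable def prod {ι : Type*} (s : Finset ι) (f : ι → Expr) : Expr :=
  (s.toList.map f).foldr mul (const 1)

variable {σ : Store}

@[simp] theorem eval_pow (e : Expr) (j : ℕ) : (e.pow j).eval σ = e.eval σ ^ j := by
  induction j with
  | zero => simp [pow, eval]
  | succ j ih => simp [pow, eval, BinOp.eval, ih, pow_succ]

@[simp] theorem eval_sum {ι : Type*} (s : Finset ι) (f : ι → Expr) :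
    (sum s f).eval σ = ∑ i ∈ s, (f i).eval σ := by
  rw [← Finset.sum_map_toList, sum]
  induction s.toList with
  | nil => simp [eval]
  | cons a l ih => simp [eval, BinOp.eval, ih]

@[simp] theorem eval_prod {ι : Type*} (s : Finset ι) (f : ι → Expr) :
    (prod s f).eval σ = ∏ i ∈ s, (f i).eval σ := by
  rw [← Finset.prod_map_toList, prod]
  induction s.toList with
  | nil => simp [eval]
  | cons a l ih => simp [eval, BinOp.eval, ih]

end Expr

open WordRAM.Expr

/-! ### Filling an interval of the memory -/

/-- The body of a loop in which variable `0` counts down, and in which the value of `e` is stored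
at address `base + i` when that variable is `i`. -/
def fillBlock (base e : Expr) : Block :=
  [.assign 0 (op .sub trivial (var 0) (const 1)), .store (base.add (var 0)) e]

/-- The store after the cells `b + (m - j), …, b + m - 1` have been filled. -/
def filled (σ : Store) (b m : ℕ) (val : ℕ → ℕ) (j : ℕ) : Store :=
  ⟨Function.update σ.var 0 (m - j),
    fun a => if b + (m - j) ≤ a ∧ a < b + m then val (a - b) else σ.mem a⟩

theorem Evaluates.fill {B : ℕ} {σ σ₁ σ' : Store} {cs : List Cmd} {t : ℕ} {base e : Expr} {b : ℕ}
    (m : ℕ) (val : ℕ → ℕ) (hm : 1 ≤ m) (hi : σ.var 0 = m) (hσ : σ.Bounded B)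
    (hb : ∀ τ : Store, (∀ r, r ≠ 0 → τ.var r = σ.var r) → base.eval τ = b)
    (hval : ∀ i < m, val i < B)
    (he : ∀ i < m, ∀ τ : Store, τ.var 0 = i → (∀ r, r ≠ 0 → τ.var r = σ.var r) →
      (∀ a, a < b ∨ b + m ≤ a → τ.mem a = σ.mem a) → e.eval τ = val i)
    (hσ₁ : filled σ b m val m = σ₁) (h : Evaluates B cs σ₁ t σ') :
    Evaluates B (.loop 0 (fillBlock base e) :: cs) σ
      (m * ((fillBlock base e).compile.length + 1) + t) σ' := by
  have hstep : ∀ j < m, (fillBlock base e).eval (filled σ b m val j) = filled σ b m val (j + 1) := by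
    intro j hj
    let τ : Store := ⟨Function.update σ.var 0 (m - (j + 1)), (filled σ b m val j).mem⟩
    have hτ : ∀ r, r ≠ 0 → τ.var r = σ.var r := fun r hr => Function.update_of_ne hr _ _
    have h₁ : base.eval τ = b := hb τ hτ
    have h₂ : e.eval τ = val (m - (j + 1)) := by
      refine he _ (by omega) τ (by simp [τ]) hτ fun a ha => ?_
      simp only [τ, filled]
      rw [if_neg (by omega)]
    have h₃ : Stmt.eval (filled σ b m val j) (.assign 0 (op .sub trivial (var 0) (const 1))) = τ := by
      simp [Stmt.eval, filled, τ, Expr.eval, BinOp.eval, Nat.sub_sub]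
    have hτ0 : τ.var 0 = m - (j + 1) := by simp [τ]
    have h₄ : Stmt.eval τ (.store (base.add (var 0)) e) =
        ⟨τ.var, Function.update τ.mem (b + (m - (j + 1))) (val (m - (j + 1)))⟩ := by
      simp only [Stmt.eval, Expr.eval, BinOp.eval, h₁, h₂, hτ0]
    rw [fillBlock, Block.eval, h₃, Block.eval, h₄]
    simp only [Block.eval, filled, τ, Store.mk.injEq, true_and]
    funext a
    by_cases ha : a = b + (m - (j + 1))
    · subst ha
      rw [Function.update_self, if_pos (by omega)]
      congr 1; omega
    · rw [Function.update_of_ne ha]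
      by_cases hc : b + (m - j) ≤ a ∧ a < b + m
      · rw [if_pos hc, if_pos (by omega)]
      · rw [if_neg hc, if_neg (by omega)]
  have hiter : ∀ j ≤ m, (fillBlock base e).eval^[j] σ = filled σ b m val j := by
    intro j hj
    induction j with
    | zero =>
      cases σ
      simp only [Function.iterate_zero, id, filled, Nat.sub_zero, ← hi, Function.update_eq_self,
        Store.mk.injEq, true_and]
      exact funext fun a => (if_neg (by omega)).symm
    | succ j ih => rw [Function.iterate_succ_apply', ih (by omega), hstep j (by omega)]
  have hbd : ∀ x ≤ m, ∀ j, Store.Bounded B ⟨Function.update σ.var 0 x, (filled σ b m val j).mem⟩ := by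
    refine fun x hx j => ⟨fun r => ?_, fun a => ?_⟩
    · by_cases hr : r = 0
      · subst hr
        simpa using (hx.trans_eq hi.symm).trans_lt (hσ.1 0)
      · simpa [Function.update_of_ne hr] using hσ.1 r
    · simp only [filled]
      split_ifs with hc
      · exact hval _ (by omega)
      · exact hσ.2 a
  obtain ⟨m, rfl⟩ : ∃ m', m = m' + 1 := ⟨m - 1, by omega⟩
  refine Evaluates.loop m (fun j hj => ?_) (fun j hj => ?_) ?_
  · rw [hiter j (by omega)]
    refine ⟨hbd _ (by omega) j, ?_, trivial⟩
    simp only [Stmt.eval, filled, Function.update_idem]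
    exact hbd _ (by simp [Expr.eval, BinOp.eval]; omega) j
  · rw [hiter _ (by omega)]
    simp [filled]
  · rwa [hiter _ le_rfl, hσ₁]

/-! ### Building the hypergraph in memory -/

/-- The `j`-th node of the tuple that is encoded by variable `0`. -/
def nodeExpr (j : ℕ) : Expr := mod (div (var 0) (pow (var 2) j)) (var 2)

/-- The entry of the adjacency matrix for the `i`-th and `j`-th node of the tuple. -/
def entryExpr (k i j : ℕ) : Expr :=
  load (add (var 3) (add (div (nodeExpr i) (const k)) (mul (div (nodeExpr j) (const k)) (var 1))))

open Classical in
/-- The colours of the tuples whose entry in the adjacency tensor is possibly not `0`. -/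
noncomputable def windowColours (u k : ℕ) : Finset (Fin u → Fin k) :=
  Finset.univ.filter fun γ => ∃ s, Finset.univ.image γ = cyclicWindow u (id : Fin k → Fin k) s

/-- The entry of the adjacency tensor for the tuple that is encoded by variable `0`. -/
noncomputable def windowExpr (u k : ℕ) : Expr :=
  sum (windowColours u k) fun γ =>
    mul (prod Finset.univ fun j : Fin u => op .eq trivial (mod (nodeExpr j) (const k)) (const (γ j)))
      (mul (prod Finset.univ.offDiag fun x : Fin u × Fin u =>
          op .lt trivial (const 0) (entryExpr k x.1 x.2))
        (sum Finset.univ fun i : Fin u => sum Finset.univ fun j : Fin u =>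
          mul (const (windowFactor u (γ i) (γ j))) (entryExpr k i j)))

/-- Replace the graph in memory by its hypergraph. -/
noncomputable def buildCmds (u k : ℕ) : List Cmd :=
  [.block [.assign 1 (load (const 0)), .assign 2 (mul (var 1) (const k)),
      .assign 3 (add (const 1) (pow (var 2) u)), .assign 0 (pow (var 1) 2)],
    .loop 0 (fillBlock (var 3) (load (add (const 1) (var 0)))),
    .block [.store (const 0) (var 2), .assign 0 (pow (var 2) u)],
    .loop 0 (fillBlock (const 1) (windowExpr u k)),
    .block [.assign 0 (pow (var 1) 2)],
    .loop 0 (fillBlock (var 3) (const 0))]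

end WordRAM

section Entries

open WordRAM

variable {n u k : ℕ} {B B' : ℝ}

theorem WeightedGraph.input_entry (G : WeightedGraph n B) (x y : Fin n) :
    G.input (1 + (x + y * n)) = G.entry x y := by
  have hlt : (x : ℕ) + y * n < n ^ 2 := by
    have := Nat.mul_le_mul_right n (Nat.succ_le_of_lt y.2)
    have := x.2
    rw [Nat.succ_mul] at *
    rw [sq]; omega
  have hx : finFunctionFinEquiv.symm (⟨1 + ((x : ℕ) + y * n) - 1, by omega⟩ : Fin (n ^ 2)) = ![x, y] := by
    rw [Equiv.symm_apply_eq]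
    apply Fin.ext
    rw [finFunctionFinEquiv_apply]
    simp
  rw [input, if_neg (by omega), dif_pos (by omega), hx]
  rfl

open Classical in
theorem WeightedHypergraph.input_entry (H : WeightedHypergraph n u B) (x : Fin u → Fin n) :
    H.input (1 + finFunctionFinEquiv x) =
      if Finset.univ.image x ∈ H.edges then H.weight (Finset.univ.image x) else 0 := by
  have hx : finFunctionFinEquiv.symm ⟨1 + (finFunctionFinEquiv x : ℕ) - 1, by omega⟩ = x := by
    rw [Equiv.symm_apply_eq]
    apply Fin.ext
    simp
  rw [input, if_neg (by omega), dif_pos (by omega)]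
  simp only [hx]

theorem mem_windowColours {γ : Fin u → Fin k} : γ ∈ windowColours u k ↔
    ∃ s, Finset.univ.image γ = cyclicWindow u (id : Fin k → Fin k) s := by
  simp [windowColours]

theorem WeightedGraph.isWindowEdge_image (G : WeightedGraph n B) (hu : u ≤ k)
    (x : Fin u → Fin (n * k)) : G.IsWindowEdge u k (Finset.univ.image x) ↔
      (fun j => (x j).modNat) ∈ windowColours u k ∧
        ∀ i j, i ≠ j → G.graph.Adj (x i).divNat (x j).divNat := by
  have himg : (Finset.univ.image x).image Fin.modNat =
      Finset.univ.image fun j => (x j).modNat := Finset.image_image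
  rw [mem_windowColours, IsWindowEdge, himg]
  constructor
  · rintro ⟨hcard, hs, hadj⟩
    have hinj : Function.Injective x := by
      rw [← Set.injOn_univ, ← Finset.coe_univ, ← Finset.card_image_iff, hcard]
      simp
    exact ⟨hs, fun i j hij => hadj _ (Finset.mem_image_of_mem x (Finset.mem_univ i)) _
      (Finset.mem_image_of_mem x (Finset.mem_univ j)) (hinj.ne hij)⟩
  · rintro ⟨⟨s, hs⟩, hadj⟩
    have hinj : Function.Injective fun j => (x j).modNat := by
      rw [← Set.injOn_univ, ← Finset.coe_univ, ← Finset.card_image_iff, hs,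
        card_cyclicWindow_id hu]
      simp
    have hx : Function.Injective x := fun i j h => hinj (congrArg Fin.modNat h)
    refine ⟨by rw [Finset.card_image_of_injective _ hx]; simp, ⟨s, hs⟩, ?_⟩
    intro y hy z hz hyz
    obtain ⟨i, -, rfl⟩ := Finset.mem_image.1 hy
    obtain ⟨j, -, rfl⟩ := Finset.mem_image.1 hz
    exact hadj i j fun h => hyz (by rw [h])

theorem eval_windowExpr (G : WeightedGraph n B) {hB : 0 ≤ B} {h2 : 2 ≤ u} {hu : u < k}
    {hk : k < 2 * u} {hB' : (u * (u * (k.factorial * B)) : ℝ) ≤ B'} {σ : Store} {i : ℕ}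
    (hi : i < (n * k) ^ u) (h0 : σ.var 0 = i) (hn : σ.var 1 = n) (hN : σ.var 2 = n * k)
    (hmem : ∀ x y : Fin n, σ.mem (σ.var 3 + (x + y * n)) = G.entry x y) :
    (windowExpr u k).eval σ = (G.windowHypergraph u k B' hB h2 hu hk hB').input (1 + i) := by
  classical
  obtain ⟨x, hx⟩ : ∃ x : Fin u → Fin (n * k), (finFunctionFinEquiv x : ℕ) = i :=
    ⟨finFunctionFinEquiv.symm ⟨i, hi⟩, by simp⟩
  have hnode : ∀ j : Fin u, (nodeExpr j).eval σ = x j := by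
    intro j
    have hxj : x j = finFunctionFinEquiv.symm (finFunctionFinEquiv x) j := by simp
    simp only [nodeExpr, Expr.eval, Expr.eval_pow, BinOp.eval, h0, hN, ← hx]
    conv_rhs => rw [hxj]
    rfl
  have hentry : ∀ i j : Fin u,
      (entryExpr k i j).eval σ = G.entry (x i).divNat (x j).divNat := by
    intro i j
    simp only [entryExpr, Expr.eval, BinOp.eval, hnode, hn]
    exact hmem (x i).divNat (x j).divNat
  have hmod : ∀ (γ : Fin u → Fin k) (j : Fin u),
      ((x j : ℕ) % k = γ j) = ((x j).modNat = γ j) := fun γ j => by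
    rw [Fin.ext_iff]; rfl
  rw [← hx, WeightedHypergraph.input_entry]
  simp only [windowExpr, Expr.eval_sum, Expr.eval_prod, Expr.eval, BinOp.eval, hnode, hentry, hmod,
    Finset.prod_boole, WeightedGraph.entry_pos, ite_mul, one_mul, zero_mul, Finset.mem_univ,
    true_imp_iff, Finset.mem_offDiag, true_and, Prod.forall]
  have hγ : ∀ γ : Fin u → Fin k, (∀ j, (x j).modNat = γ j) = (γ = fun j => (x j).modNat) :=
    fun γ => propext ⟨fun h => funext fun j => (h j).symm, fun h j => by rw [h]⟩
  simp only [hγ, Finset.sum_ite_eq']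
  rw [← ite_and]
  have hedge := G.isWindowEdge_image hu.le x
  rw [show (Finset.univ.image x ∈ (G.windowHypergraph u k B' hB h2 hu hk hB').edges) =
    G.IsWindowEdge u k (Finset.univ.image x) from rfl]
  simp only [hedge]
  refine if_ctx_congr Iff.rfl (fun h => ?_) fun _ => rfl
  have hcard := (hedge.2 h).1
  have hinj : Function.Injective x := by
    rw [← Set.injOn_univ, ← Finset.coe_univ, ← Finset.card_image_iff, hcard]
    simp
  simp only [WeightedGraph.windowHypergraph, WeightedGraph.windowWeight,
    Finset.sum_image hinj.injOn]

end Entries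

section Inputs

variable {n u : ℕ} {B : ℝ}

theorem WeightedGraph.input_zero (G : WeightedGraph n B) : G.input 0 = n := if_pos rfl

theorem WeightedGraph.input_eq_zero (G : WeightedGraph n B) {a : ℕ} (h : n ^ 2 < a) :
    G.input a = 0 := by
  rw [input, if_neg (by omega), dif_neg (by omega)]

theorem WeightedGraph.input_lt (G : WeightedGraph n B) {X : ℕ} (hn : n < X) (hB : B < X) (a : ℕ) :
    G.input a < X := by
  have h0 : 0 < X := by omega
  unfold input
  split_ifs with h₁ h₂
  · exact hn
  · dsimp only
    split_ifs with h₃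
    · exact_mod_cast (G.weight_le _ h₃).trans_lt hB
    · exact h0
  · exact h0

theorem WeightedHypergraph.input_zero (H : WeightedHypergraph n u B) : H.input 0 = n := if_pos rfl

theorem WeightedHypergraph.input_eq_zero (H : WeightedHypergraph n u B) {a : ℕ} (h : n ^ u < a) :
    H.input a = 0 := by
  rw [input, if_neg (by omega), dif_neg (by omega)]

theorem WeightedHypergraph.input_lt (H : WeightedHypergraph n u B) {X : ℕ} (hn : n < X)
    (hB : B < X) (a : ℕ) : H.input a < X := by
  have h0 : 0 < X := by omega
  unfold input
  split_ifs with h₁ h₂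
  · exact hn
  · dsimp only
    split_ifs with h₃
    · exact_mod_cast (H.weight_le _ h₃).trans_lt hB
    · exact h0
  · exact h0

end Inputs

namespace WordRAM

open WordRAM.Expr

theorem Store.bounded_mk {B a b c d : ℕ} {mem : ℕ → ℕ} (ha : a < B) (hb : b < B) (hc : c < B)
    (hd : d < B) (hm : ∀ x, mem x < B) : Store.Bounded B ⟨![a, b, c, d], mem⟩ := by
  refine ⟨fun r => ?_, hm⟩
  fin_cases r <;> assumption

theorem update_vec_zero (a b c d x : ℕ) :
    Function.update ![a, b, c, d] (0 : Fin 4) x = ![x, b, c, d] := by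
  funext i; fin_cases i <;> rfl

theorem update_vec_one (a b c d x : ℕ) :
    Function.update ![a, b, c, d] (1 : Fin 4) x = ![a, x, c, d] := by
  funext i; fin_cases i <;> rfl

theorem update_vec_two (a b c d x : ℕ) :
    Function.update ![a, b, c, d] (2 : Fin 4) x = ![a, b, x, d] := by
  funext i; fin_cases i <;> rfl

theorem update_vec_three (a b c d x : ℕ) :
    Function.update ![a, b, c, d] (3 : Fin 4) x = ![a, b, c, x] := by
  funext i; fin_cases i <;> rfl

theorem filled_vec (a b c d : ℕ) (mem : ℕ → ℕ) (l m : ℕ) (val : ℕ → ℕ) :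
    filled ⟨![a, b, c, d], mem⟩ l m val m =
      ⟨![0, b, c, d], fun x => if l ≤ x ∧ x < l + m then val (x - l) else mem x⟩ := by
  simp only [filled, Nat.sub_self, Nat.add_zero, update_vec_zero]

theorem Evaluates.block_of_eq {B t : ℕ} {l : Block} {cs : List Cmd} {σ σ₁ σ' : Store}
    (hl : l.Safe B σ) (hσ : l.eval σ = σ₁) (h : Evaluates B cs σ₁ t σ') :
    Evaluates B (.block l :: cs) σ (l.compile.length + t) σ' :=
  .block hl (hσ ▸ h)

theorem evaluates_buildCmds {n u k : ℕ} {B B' : ℝ} (G : WeightedGraph n B) {hB : 0 ≤ B}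
    {h2 : 2 ≤ u} {hu : u < k} {hk : k < 2 * u} {hB' : (u * (u * (k.factorial * B)) : ℝ) ≤ B'}
    (hn : 1 ≤ n) {X : ℕ} (hX : 1 + (n * k) ^ u < X) (hG : ∀ a, G.input a < X)
    (hH : ∀ a, (G.windowHypergraph u k B' hB h2 hu hk hB').input a < X) :
    ∃ t σ, Evaluates X (buildCmds u k) ⟨fun _ => 0, G.input⟩ t σ ∧
      σ.mem = (G.windowHypergraph u k B' hB h2 hu hk hB').input ∧
      t ≤ ((Cmd.compileAll 0 (buildCmds u k)).length + 3) * (n * k) ^ u := by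
  set H := G.windowHypergraph u k B' hB h2 hu hk hB'
  obtain ⟨N, hN⟩ : ∃ N, N = n * k := ⟨_, rfl⟩
  have hN' : ∀ t, t ≤ ((Cmd.compileAll 0 (buildCmds u k)).length + 3) * N ^ u →
      t ≤ ((Cmd.compileAll 0 (buildCmds u k)).length + 3) * (n * k) ^ u := fun t h => hN ▸ h
  rw [← hN] at hX
  have hnN : n ≤ N := hN ▸ Nat.le_mul_of_pos_right n (by omega)
  have hN1 : 1 ≤ N := hn.trans hnN
  have hNu : N ≤ N ^ u := Nat.le_self_pow (by omega) N
  have hn2 : n ^ 2 ≤ N ^ u := (Nat.pow_le_pow_left hnN 2).trans (Nat.pow_le_pow_right hN1 h2)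
  have hn2' : 1 ≤ n ^ 2 := Nat.one_le_pow _ _ hn
  let mem₁ : ℕ → ℕ := fun x =>
    if 1 + N ^ u ≤ x ∧ x < 1 + N ^ u + n ^ 2 then G.input (1 + (x - (1 + N ^ u))) else G.input x
  let mem₂ : ℕ → ℕ := Function.update mem₁ 0 N
  let mem₃ : ℕ → ℕ := fun x => if 1 ≤ x ∧ x < 1 + N ^ u then H.input (1 + (x - 1)) else mem₂ x
  have hm₁ : ∀ x, mem₁ x < X := fun x => by simp only [mem₁]; split_ifs <;> exact hG _
  have hm₂ : ∀ x, mem₂ x < X := fun x => by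
    by_cases hx : x = 0
    · subst hx; simp only [mem₂, Function.update_self]; omega
    · simpa [mem₂, Function.update_of_ne hx] using hm₁ x
  have hm₃ : ∀ x, mem₃ x < X := fun x => by
    simp only [mem₃]; split_ifs
    · exact hH _
    · exact hm₂ _
  have hvar : (fun _ => 0 : Fin 4 → ℕ) = ![0, 0, 0, 0] := by funext i; fin_cases i <;> rfl
  have h₆ := Evaluates.fill (σ := ⟨![n ^ 2, n, N, 1 + N ^ u], mem₃⟩) (base := var 3) (e := const 0)
    (b := 1 + N ^ u) (n ^ 2) (fun _ => 0) hn2' rfl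
    (Store.bounded_mk (by omega) (by omega) (by omega) hX hm₃)
    (fun τ hτ => hτ 3 (by decide)) (fun _ _ => by omega) (fun _ _ _ _ _ _ => rfl)
    (filled_vec _ _ _ _ _ _ _ _) (Evaluates.nil _)
  have h₅ := Evaluates.block_of_eq (l := [.assign 0 (pow (var 1) 2)])
    (σ := ⟨![0, n, N, 1 + N ^ u], mem₃⟩)
    ⟨Store.bounded_mk (by omega) (by omega) (by omega) hX hm₃, trivial⟩
    (by simp only [Block.eval, Stmt.eval, eval_pow, Expr.eval, update_vec_zero]; rfl) h₆
  have h₄ := Evaluates.fill (σ := ⟨![N ^ u, n, N, 1 + N ^ u], mem₂⟩) (base := const 1)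
    (e := windowExpr u k) (b := 1) (N ^ u) (fun i => H.input (1 + i)) (by omega) rfl
    (Store.bounded_mk (by omega) (by omega) (by omega) hX hm₂)
    (fun τ hτ => rfl) (fun _ _ => hH _) (by
      intro i hi τ h0 hτ hmem
      refine eval_windowExpr G (hN ▸ hi) h0 (hτ 1 (by decide)) ((hτ 2 (by decide)).trans hN)
        fun x y => ?_
      have hxy : (x : ℕ) + y * n < n ^ 2 := by
        have := Nat.mul_le_mul_right n (Nat.succ_le_of_lt y.2)
        have := x.2
        rw [Nat.succ_mul] at *
        rw [sq]; omega
      rw [hτ 3 (by decide)]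
      change τ.mem (1 + N ^ u + _) = _
      rw [hmem _ (by omega)]
      simp only [mem₂, mem₁]
      rw [Function.update_of_ne (by omega), if_pos (by omega), Nat.add_sub_cancel_left,
        G.input_entry]) (filled_vec _ _ _ _ _ _ _ _) h₅
  have h₃ := Evaluates.block_of_eq (l := [.store (const 0) (var 2), .assign 0 (pow (var 2) u)])
    (σ := ⟨![0, n, N, 1 + N ^ u], mem₁⟩)
    ⟨Store.bounded_mk (by omega) (by omega) (by omega) hX hm₁,
      Store.bounded_mk (by omega) (by omega) (by omega) hX hm₂, trivial⟩
    (by simp only [Block.eval, Stmt.eval, eval_pow, Expr.eval, update_vec_zero]; rfl) h₄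
  have h₂ := Evaluates.fill (σ := ⟨![n ^ 2, n, N, 1 + N ^ u], G.input⟩) (base := var 3)
    (e := load (add (const 1) (var 0))) (b := 1 + N ^ u) (n ^ 2) (fun i => G.input (1 + i)) hn2' rfl
    (Store.bounded_mk (by omega) (by omega) (by omega) hX hG)
    (fun τ hτ => hτ 3 (by decide)) (fun _ _ => hG _) (by
      intro i hi τ h0 hτ hmem
      simp only [Expr.eval, BinOp.eval, h0]
      exact hmem _ (by omega)) (filled_vec _ _ _ _ _ _ _ _) h₃
  have h₁ := Evaluates.block_of_eq (l := [.assign 1 (load (const 0)),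
      .assign 2 (mul (var 1) (const k)), .assign 3 (add (const 1) (pow (var 2) u)),
      .assign 0 (pow (var 1) 2)])
    (σ := ⟨![0, 0, 0, 0], G.input⟩)
    ⟨Store.bounded_mk (by omega) (by omega) (by omega) (by omega) hG, by
      simp only [Block.Safe, Stmt.eval, eval_pow, Expr.eval, BinOp.eval, update_vec_one,
        update_vec_two, update_vec_three, G.input_zero]
      simp only [Matrix.cons_val, ← hN]
      exact ⟨Store.bounded_mk (by omega) (by omega) (by omega) (by omega) hG,
        Store.bounded_mk (by omega) (by omega) (by omega) (by omega) hG,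
        Store.bounded_mk (by omega) (by omega) (by omega) hX hG, trivial⟩⟩
    (by
      simp only [Block.eval, Stmt.eval, eval_pow, Expr.eval, BinOp.eval, update_vec_zero,
        update_vec_one, update_vec_two, update_vec_three, G.input_zero]
      simp only [Matrix.cons_val, ← hN]) h₂
  rw [← hvar] at h₁
  refine ⟨_, _, h₁, ?_, hN' _ ?_⟩
  · funext a
    simp only [mem₃, mem₂, mem₁]
    by_cases h0 : a = 0
    · subst h0
      rw [if_neg (by omega), if_neg (by omega), Function.update_self, H.input_zero, hN]
    · rw [Function.update_of_ne h0]
      split_ifs with h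
      · exact (H.input_eq_zero (by rw [← hN]; omega)).symm
      · congr 1; omega
      · rw [G.input_eq_zero (by omega), H.input_eq_zero (by rw [← hN]; omega)]
  · simp only [buildCmds, Cmd.compileAll, Cmd.compile, List.length_append, List.length_cons,
      List.length_nil]
    generalize N ^ u = m at *
    generalize n ^ 2 = m' at *
    generalize (Block.compile _).length = a₁
    generalize (Block.compile _).length = a₂
    generalize (Block.compile _).length = a₃
    generalize (Block.compile _).length = a₄
    generalize (Block.compile _).length = a₅
    generalize (Block.compile _).length = a₆
    have hm : 1 ≤ m := by omega
    nlinarith [Nat.mul_le_mul_right (a₂ + 1) hn2, Nat.mul_le_mul_right (a₆ + 1) hn2,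
      Nat.mul_le_mul_right a₁ hm, Nat.mul_le_mul_right a₃ hm, Nat.mul_le_mul_right a₅ hm]

/-! ### Translating the answer -/

/-- Divide the contents of the memory cells `1, …, m` by `k`. -/
def divideBlock (k : ℕ) : ℕ → Block
  | 0 => []
  | m + 1 => .store (const (m + 1)) (div (load (const (m + 1))) (const k)) :: divideBlock k m

theorem eval_divideBlock (k m : ℕ) (σ : Store) : (divideBlock k m).eval σ =
    ⟨σ.var, fun a => if 1 ≤ a ∧ a ≤ m then σ.mem a / k else σ.mem a⟩ := by
  induction m generalizing σ with
  | zero =>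
    cases σ
    simp only [divideBlock, Block.eval, Store.mk.injEq, true_and]
    exact funext fun a => (if_neg (by omega)).symm
  | succ m ih =>
    simp only [divideBlock, Block.eval, ih, Stmt.eval, Expr.eval, BinOp.eval, Store.mk.injEq,
      true_and]
    funext a
    by_cases ha : a = m + 1
    · subst ha
      rw [if_neg (by omega), if_pos (by omega), Function.update_self]
    · rw [Function.update_of_ne ha]
      exact if_congr (by omega) rfl rfl

theorem safe_divideBlock {B : ℕ} (k m : ℕ) {σ : Store} (hσ : σ.Bounded B) :
    (divideBlock k m).Safe B σ := by
  induction m generalizing σ with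
  | zero => trivial
  | succ m ih =>
    refine ⟨hσ, ih ⟨hσ.1, fun a => ?_⟩⟩
    simp only [Stmt.eval, Expr.eval, BinOp.eval]
    by_cases ha : a = m + 1
    · subst ha
      simpa using (Nat.div_le_self _ _).trans_lt (hσ.2 (m + 1))
    · simpa [Function.update_of_ne ha] using hσ.2 a

/-! ### The reduction -/

/-- A bound on the number of registers that are used to build the hypergraph. -/
noncomputable def buildRegs (u k : ℕ) : ℕ := Cmd.sizeAll (buildCmds u k) + 5

/-- The part of the reduction that precedes the given program. -/
noncomputable def buildCode (u k : ℕ) : Program :=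
  Cmd.compileAll 0 (buildCmds u k) ++ clearCode 0 (buildRegs u k)

/-- Build the hypergraph, run program `p` on it, and translate the answer. -/
noncomputable def cliqueProgram (u k : ℕ) (p : Program) : Program :=
  buildCode u k ++ p.relocate (buildCode u k).length ++ (divideBlock k k).compile

theorem cliqueProgram_deterministic {u k : ℕ} {p : Program} (hp : p.Deterministic) :
    (cliqueProgram u k p).Deterministic := by
  intro r
  simp [cliqueProgram, buildCode, Cmd.flip_notMem_compileAll, flip_notMem_clearCode,
    flip_mem_relocate, Block.flip_notMem_compile, hp r]

theorem HaltsWithin.mono {p : Program} {w : ℕ} {ω : ℕ → Bool} {input : ℕ → ℕ} {T T' : ℝ}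
    {Q Q' : (ℕ → ℕ) → Prop} (hT : T ≤ T') (hQ : ∀ mem, Q mem → Q' mem)
    (h : HaltsWithin p w ω input T Q) : HaltsWithin p w ω input T' Q' := by
  obtain ⟨t, s, ht, hs, hpc, hmem⟩ := h
  exact ⟨t, s, ht.trans hT, hs, hpc, hQ _ hmem⟩

theorem haltsWithin_cliqueProgram {u k t w v w' : ℕ} {p : Program} {ω : ℕ → Bool}
    {input input' : ℕ → ℕ} {σ : Store} {T : ℝ} {Q : (ℕ → ℕ) → Prop} (hv : 1 ≤ v) (hwv : w ≤ v)
    (hw' : v * (Cmd.sizeAll (buildCmds u k) + (divideBlock k k).size + 1) ≤ w')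
    (hbuild : Evaluates (2 ^ v) (buildCmds u k) ⟨fun _ => 0, input⟩ t σ) (hσ : σ.mem = input')
    (hinput' : ∀ a, input' a < 2 ^ v) (h : HaltsWithin p w ω input' T Q) :
    HaltsWithin (cliqueProgram u k p) w' ω input
      (t + buildRegs u k + T + (divideBlock k k).compile.length) fun mem' =>
        ∃ mem, Q mem ∧ mem' 0 = mem 0 ∧ ∀ i < k, mem' (i + 1) = mem (i + 1) / k := by
  obtain ⟨tp, s, htp, hs, hpc, hQ⟩ := h
  have h2 : 2 ≤ 2 ^ v := Nat.le_self_pow (by omega) 2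
  have hpow : ∀ {a : ℕ}, a ≤ Cmd.sizeAll (buildCmds u k) + (divideBlock k k).size + 1 →
      (2 ^ v) ^ a ≤ 2 ^ w' := fun ha => by
    rw [← pow_mul]
    exact Nat.pow_le_pow_right two_pos ((Nat.mul_le_mul_left v ha).trans hw')
  have hvw' : v ≤ w' := (Nat.le_mul_of_pos_right v (by omega)).trans hw'
  set q := cliqueProgram u k p with hq
  have hqb : CodeAt q 0 (buildCode u k) := by
    have := CodeAt.append [] (buildCode u k)
      (p.relocate (buildCode u k).length ++ (divideBlock k k).compile)
    simpa [hq, cliqueProgram] using this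
  have hqp : CodeAt q (buildCode u k).length (p.relocate (buildCode u k).length) :=
    CodeAt.append _ _ _
  have hqd : CodeAt q ((buildCode u k).length + p.length) (divideBlock k k).compile := by
    have := CodeAt.append (buildCode u k ++ p.relocate (buildCode u k).length)
      (divideBlock k k).compile []
    simpa [hq, cliqueProgram, Program.relocate] using this
  obtain ⟨reg₁, h₁, -, hreg₁⟩ := hbuild.exec h2 hqb.left (hpow (by omega))
    (R := buildRegs u k) le_rfl (ω := ω) (fun _ => 0) 0 fun _ => rfl
  have h₂ := run_clearCode (w := w') (ω := ω) hqb.right (a := 0) (m := buildRegs u k) (reg := reg₁) (mem := σ.mem) (coins := 0)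
    (fun r hr => hreg₁ r (by omega))
  have h₃ := run_relocate hqp (run_mono (hwv.trans hvw') hs)
  have hsv : s.Bounded (2 ^ v) :=
    Config.Bounded.run ⟨fun _ => by simp [initial], hinput'⟩ (run_mono hwv hs)
  let τ : Store := ⟨fun r => s.reg r, s.mem⟩
  obtain ⟨reg₄, h₄, -, -⟩ := Block.exec_compile (q := q) (w := w') (ω := ω) (σ := τ) h2
    (divideBlock k k) (safe_divideBlock k k ⟨fun r => hsv.1 r, hsv.2⟩) hqd (hpow (by omega))
    (le_refl _) s.reg s.coins fun _ => rfl
  rw [eval_divideBlock] at h₄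
  have hlen : (buildCode u k).length =
      0 + (Cmd.compileAll 0 (buildCmds u k)).length + buildRegs u k := by
    simp [buildCode]
  have e₂ : (⟨0 + (Cmd.compileAll 0 (buildCmds u k)).length + buildRegs u k, fun _ => 0, σ.mem, 0⟩
      : Config) = (initial input').relocate (buildCode u k).length p.length := by
    simp [Config.relocate, initial, hσ, hlen]
  have e₃ : s.relocate (buildCode u k).length p.length =
      ⟨(buildCode u k).length + p.length, s.reg, τ.mem, s.coins⟩ := by
    simp [Config.relocate, min_eq_right hpc, τ]
  rw [e₂] at h₂
  rw [e₃] at h₃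
  refine ⟨_, _, ?_, run_trans (run_trans (run_trans h₁ h₂) h₃) h₄, ?_, s.mem, hQ, ?_, ?_⟩
  · push_cast
    gcongr
  · simp [hq, cliqueProgram, Program.relocate, Nat.add_assoc]
  · simp [τ]
  · exact fun i hi => if_pos (by omega)

end WordRAM

theorem factorial_mul_rpow_le {n u k : ℕ} {c : ℝ} (hc : 1 < c) (hn : 1 ≤ n) (h2 : 2 ≤ u)
    (hu : u < k) : (u * (u * (k.factorial * (n : ℝ) ^ (c * k))) : ℝ) ≤
      ((n * k : ℕ) : ℝ) ^ ((c + 1) * k) := by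
  have hn' : (1 : ℝ) ≤ n := by exact_mod_cast hn
  have hk' : (1 : ℝ) ≤ k := by exact_mod_cast (by omega : 1 ≤ k)
  have hu' : (u : ℝ) ≤ k := by exact_mod_cast hu.le
  have h2k : (2 : ℝ) ≤ k := by exact_mod_cast h2.trans hu.le
  have h₁ : (u * u : ℝ) ≤ (k : ℝ) ^ (c * k) := calc
    (u * u : ℝ) ≤ k * k := mul_le_mul hu' hu' (by positivity) (by positivity)
    _ = (k : ℝ) ^ (2 : ℝ) := by rw [Real.rpow_two, sq]
    _ ≤ (k : ℝ) ^ (c * k) := Real.rpow_le_rpow_of_exponent_le hk' (by nlinarith)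
  have h₂ : (k.factorial : ℝ) ≤ ((n : ℝ) * k) ^ k := calc
    (k.factorial : ℝ) ≤ (k : ℝ) ^ k := by exact_mod_cast Nat.factorial_le_pow k
    _ ≤ ((n : ℝ) * k) ^ k := pow_le_pow_left₀ (by positivity) (by nlinarith) k
  have hpos : (0 : ℝ) < n * k := mul_pos (by linarith) (by linarith)
  rw [Nat.cast_mul, add_mul, one_mul, Real.rpow_add hpos, Real.rpow_natCast,
    Real.mul_rpow (by positivity) (by positivity)]
  calc (u * (u * (k.factorial * (n : ℝ) ^ (c * k))) : ℝ)
      = (n : ℝ) ^ (c * k) * (u * u) * k.factorial := by ring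
    _ ≤ (n : ℝ) ^ (c * k) * (k : ℝ) ^ (c * k) * ((n : ℝ) * k) ^ k := by gcongr

theorem mul_lt_two_pow_log (n k : ℕ) : n * k < 2 ^ ((Nat.log 2 n + 1) * (k + 1)) := by
  have h₁ := Nat.lt_pow_succ_log_self (b := 2) (by norm_num) n
  have h₂ : k < 2 ^ ((Nat.log 2 n + 1) * k) := Nat.lt_two_pow_self.trans_le
    (Nat.pow_le_pow_right two_pos (Nat.le_mul_of_pos_left k (by omega)))
  rw [Nat.mul_succ, Nat.add_comm, pow_add]
  exact (Nat.mul_le_mul_left n h₂.le).trans_lt (Nat.mul_lt_mul_of_pos_right h₁ (by positivity))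

open WordRAM

/-- The exponent of the word length on which the reduction works. -/
noncomputable def wordFactor (c : ℝ) (d u k : ℕ) : ℕ := (d + u + ⌈(c + 1) * k⌉₊ + 2) * (k + 1)

theorem haltsWithin_cliqueProgram_input {n u k d : ℕ} {c : ℝ} (hc : 1 < c) (hn : 1 ≤ n) (h2 : 2 ≤ u)
    (hu : u < k) (hk : k < 2 * u) (G : WeightedGraph n ((n : ℝ) ^ (c * k))) {p : Program} :
    ∃ H : WeightedHypergraph (n * k) u (((n * k : ℕ) : ℝ) ^ ((c + 1) * k)),
      (∀ mem mem', H.CorrectAnswer k mem → mem' 0 = mem 0 →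
        (∀ i < k, mem' (i + 1) = mem (i + 1) / k) → G.CorrectAnswer k mem') ∧
      ∀ ω T Q, HaltsWithin p (d * (Nat.log 2 (n * k) + 1)) ω H.input T Q →
        HaltsWithin (cliqueProgram u k p) (wordFactor c d u k *
            (Cmd.sizeAll (buildCmds u k) + (divideBlock k k).size + 1) * (Nat.log 2 n + 1)) ω
          G.input (((Cmd.compileAll 0 (buildCmds u k)).length + 3) * ((n * k : ℕ) : ℝ) ^ u +
            buildRegs u k + T + (divideBlock k k).compile.length) fun mem' =>
          ∃ mem, Q mem ∧ mem' 0 = mem 0 ∧ ∀ i < k, mem' (i + 1) = mem (i + 1) / k := by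
  have hB : (0 : ℝ) ≤ (n : ℝ) ^ (c * k) := by positivity
  let H := G.windowHypergraph u k (((n * k : ℕ) : ℝ) ^ ((c + 1) * k)) hB h2 hu hk
    (factorial_mul_rpow_le hc hn h2 hu)
  refine ⟨H, fun mem mem' h h0 h' => G.correctAnswer_of_windowHypergraph h h0 h', ?_⟩
  intro ω T Q h
  set l := Nat.log 2 n + 1 with hl
  have hl1 : 1 ≤ l := by omega
  set e := ⌈(c + 1) * k⌉₊ with he
  set v := wordFactor c d u k * l with hv
  have hlog := mul_lt_two_pow_log n k
  rw [← hl] at hlog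
  have hN1 : 1 ≤ n * k := Nat.mul_pos hn (by omega)
  have hle : ∀ a ≤ d + u + e + 2, 2 ^ (l * (k + 1) * a) ≤ 2 ^ v := fun a ha => by
    refine Nat.pow_le_pow_right two_pos ?_
    calc l * (k + 1) * a ≤ l * (k + 1) * (d + u + e + 2) := Nat.mul_le_mul_left _ ha
      _ = v := by rw [hv, wordFactor, ← he]; ring
  have hpow : ∀ a, a + 1 ≤ d + u + e + 2 → (n * k) ^ a < 2 ^ v := fun a ha => by
    refine lt_of_lt_of_le ?_ (hle (a + 1) ha)
    rw [pow_mul]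
    exact (Nat.pow_lt_pow_right (a := 2 ^ (l * (k + 1))) (Nat.one_lt_two_pow (by positivity))
      (Nat.lt_succ_self a)).trans_le' (Nat.pow_le_pow_left hlog.le a)
  have hNv : n * k < 2 ^ v := by simpa using hpow 1 (by omega)
  have hnv : n < 2 ^ v := (Nat.le_mul_of_pos_right n (by omega)).trans_lt hNv
  have hX : 1 + (n * k) ^ u < 2 ^ v := by
    have h₁ : (n * k) ^ u < (2 ^ (l * (k + 1))) ^ u := Nat.pow_lt_pow_left hlog (by omega)
    have h₂ : (2 ^ (l * (k + 1))) ^ u < (2 ^ (l * (k + 1))) ^ (u + 1) :=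
      Nat.pow_lt_pow_right (Nat.one_lt_two_pow (by positivity)) (Nat.lt_succ_self u)
    have h₃ := hle (u + 1) (by omega)
    rw [pow_mul] at h₃
    omega
  have hB' : ((n * k : ℕ) : ℝ) ^ ((c + 1) * k) < (2 ^ v : ℕ) := calc
    ((n * k : ℕ) : ℝ) ^ ((c + 1) * k) ≤ ((n * k : ℕ) : ℝ) ^ (e : ℝ) :=
      Real.rpow_le_rpow_of_exponent_le (by exact_mod_cast hN1) (Nat.le_ceil _)
    _ = (((n * k) ^ e : ℕ) : ℝ) := by rw [Real.rpow_natCast]; push_cast; rfl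
    _ < (2 ^ v : ℕ) := by exact_mod_cast hpow e (by omega)
  have hB₀ : (n : ℝ) ^ (c * k) ≤ ((n * k : ℕ) : ℝ) ^ ((c + 1) * k) := by
    refine le_trans ?_ (factorial_mul_rpow_le hc hn h2 hu)
    have h₁ : (1 : ℝ) ≤ u := by exact_mod_cast (by omega : 1 ≤ u)
    have h₂ : (1 : ℝ) ≤ k.factorial := by exact_mod_cast k.factorial_pos
    rw [← mul_assoc, ← mul_assoc]
    exact le_mul_of_one_le_left hB (by nlinarith [one_le_mul_of_one_le_of_one_le h₁ h₁])
  have hH : ∀ a, H.input a < 2 ^ v := H.input_lt hNv hB'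
  obtain ⟨t, σ, hev, hσ, ht⟩ := evaluates_buildCmds G hn hX
    (G.input_lt hnv (hB₀.trans_lt hB')) hH
  have hvpos : 1 ≤ v := by rw [hv, wordFactor]; exact Nat.mul_pos (by positivity) hl1
  have hwv : d * (Nat.log 2 (n * k) + 1) ≤ v := by
    have h₁ : Nat.log 2 (n * k) < l * (k + 1) := Nat.log_lt_of_lt_pow (by omega) hlog
    calc d * (Nat.log 2 (n * k) + 1) ≤ (d + u + e + 2) * (l * (k + 1)) :=
        Nat.mul_le_mul (by omega) h₁
      _ = v := by rw [hv, wordFactor, ← he]; ring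
  refine (haltsWithin_cliqueProgram hvpos hwv ?_ hev hσ hH h).mono ?_ fun _ h => h
  · rw [hv]
    exact (Nat.mul_right_comm _ _ _).le
  · have ht' : (t : ℝ) ≤ ((Cmd.compileAll 0 (buildCmds u k)).length + 3) *
        ((n * k : ℕ) : ℝ) ^ u := by exact_mod_cast ht
    linarith

theorem solvableInTime_minCliqueProblem {m : Mode} {u k : ℕ} {c ε : ℝ} (hc : 1 < c) (h2 : 2 ≤ u)
    (hu : u < k) (hk : k < 2 * u) (h : SolvableInTime m (minHypercycleProblem (c + 1) u k) (k - ε)) :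
    SolvableInTime m (minCliqueProblem c k) (k - min ε 1) := by
  obtain ⟨p, d, C, hp⟩ := h
  set a : ℝ := (Cmd.compileAll 0 (buildCmds u k)).length + 3
  set b : ℝ := ((buildRegs u k : ℕ) : ℝ)
  set b' : ℝ := ((divideBlock k k).compile.length : ℝ)
  set e : ℝ := k - min ε 1
  refine ⟨cliqueProgram u k p, wordFactor c d u k *
    (Cmd.sizeAll (buildCmds u k) + (divideBlock k k).size + 1), (a + b + |C| + b') * (k : ℝ) ^ e,
    fun n hn G => ?_⟩
  have hN : 1 ≤ n * k := Nat.mul_pos hn (by omega)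
  have hN' : (1 : ℝ) ≤ ((n * k : ℕ) : ℝ) := by exact_mod_cast hN
  have hu' : (u : ℝ) ≤ e := by
    have h₁ : (u : ℝ) + 1 ≤ k := by exact_mod_cast hu
    have h₂ := min_le_right ε 1
    simp only [e]; linarith
  have ha : 0 ≤ a := by positivity
  have hb : 0 ≤ b := by positivity
  have hb' : 0 ≤ b' := by positivity
  have htime : a * ((n * k : ℕ) : ℝ) ^ u + b + C * ((n * k : ℕ) : ℝ) ^ (k - ε) + b' ≤
      (a + b + |C| + b') * (k : ℝ) ^ e * (n : ℝ) ^ e := by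
    rw [mul_assoc, ← Real.mul_rpow (by positivity) (by positivity), mul_comm (k : ℝ),
      ← Nat.cast_mul]
    have h₁ : ((n * k : ℕ) : ℝ) ^ u ≤ ((n * k : ℕ) : ℝ) ^ e := by
      rw [← Real.rpow_natCast]
      exact Real.rpow_le_rpow_of_exponent_le hN' hu'
    have h₂ : (1 : ℝ) ≤ ((n * k : ℕ) : ℝ) ^ e :=
      Real.one_le_rpow hN' ((Nat.cast_nonneg u).trans hu')
    have h₃ : ((n * k : ℕ) : ℝ) ^ (k - ε) ≤ ((n * k : ℕ) : ℝ) ^ e :=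
      Real.rpow_le_rpow_of_exponent_le hN' (sub_le_sub_left (min_le_left ε 1) _)
    have h₄ : C * ((n * k : ℕ) : ℝ) ^ (k - ε) ≤ |C| * ((n * k : ℕ) : ℝ) ^ e :=
      mul_le_mul (le_abs_self C) h₃ (by positivity) (abs_nonneg C)
    have h₅ := mul_le_mul_of_nonneg_left h₁ ha
    have h₆ := mul_le_mul_of_nonneg_left h₂ hb
    have h₇ := mul_le_mul_of_nonneg_left h₂ hb'
    linarith
  obtain ⟨H, hcorrect, hrun⟩ :=
    haltsWithin_cliqueProgram_input (d := d) hc hn h2 hu hk G (p := p)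
  have hH := hp (n * k) hN H
  have hrun' : ∀ ω, HaltsWithin p (d * (Nat.log 2 (n * k) + 1)) ω H.input
      (C * ((n * k : ℕ) : ℝ) ^ (k - ε)) (H.CorrectAnswer k) →
      HaltsWithin (cliqueProgram u k p) _ ω G.input _ (G.CorrectAnswer k) := fun ω h =>
    (hrun ω _ _ h).mono htime fun mem' ⟨mem, hQ, h0, h'⟩ => hcorrect mem mem' hQ h0 h'
  cases m with
  | deterministic =>
    exact ⟨cliqueProgram_deterministic hH.1, fun ω => hrun' ω (hH.2 ω)⟩
  | randomized =>
    refine ⟨fun ω => (hrun ω _ _ (hH.1 ω)).mono htime fun _ _ => trivial, ?_⟩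
    exact hH.2.trans (MeasureTheory.measure_mono fun ω h => hrun' ω h)

theorem mainTheorem1 (m : WordRAM.Mode) (u k : ℕ) (hk : k ∈ Set.Icc (u + 1) (2 * u - 1))
    (hyp : MinCliqueHypothesis m k) :
    ∃ c : ℝ, 1 < c ∧ WordRAM.RequiresTime m (minHypercycleProblem c u k) k := by
  obtain ⟨h₁, h₂⟩ := hk
  obtain ⟨c, hc, hreq⟩ := hyp
  refine ⟨c + 1, by linarith, fun ε hε h => ?_⟩
  exact hreq (min ε 1) (lt_min hε one_pos)
    (solvableInTime_minCliqueProblem hc (by omega) (by omega) (by omega) h)
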